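/- Let $\mu$ be a finite Borel measure on $\mathbb R^d$ with compact support, and let $B_r(x)$ denote the closed Euclidean ball of radius $r$ centred at $x$. For $q\in\mathbb R$ and $r>0$ put $$\Theta(q;r)=\sup\sum_i\mu(B_r(x_i))^q,\qquad \tau(q)=\liminf_{r\to0+}\frac{\log\Theta(q;r)}{\log r},$$ where the supremum is over all families of pairwise disjoint balls $B_r(x_i)$ with $x_i\in\operatorname{supp}\mu$. Assume that $\tau(q)\in\mathbb R$ for every $q\in\mathbb R$. For $\alpha\in\mathbb R$ let $$E(\alpha)=\Big\{x\in\mathbb R^d:\ \lim_{r\to0+}\frac{\log\mu(B_r(x))}{\log r}=\alpha\Big\},\qquad \tau^*(\alpha)=\inf\{\alpha q-\tau(q):q\in\mathbb R\}.$$ Let $\Omega$ be the set of $q\in\mathbb R$ at which $\tau$ is differentiable, and $\Omega_+=\Omega\cap(0,\infty)$. We say that $\mu$ has an *asymptotically good multifractal structure over $\mathbb R$* (respectively *over $\mathbb R_+$*) if there is a dense subset $\Lambda$ of $\Omega$ (respectively of $\Omega_+$) such that for each $q\in\Lambda$ and each integer $k\ge1$ there are positive numbers $a(q,k)$, $b(q,k)$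 and $f_n(q,k)$, $n=0,1,2,\dots$, with the following properties. (i) For each $q\in\Lambda$, $\lim_{k\to\infty}b(q,k)=0$; and for each $q\in\Lambda$ and $k\ge1$, $\lim_{n\to\infty}f_n(q,k)/n=0$. (ii) Whenever $q\in\Lambda$, $k\ge1$, $n\ge0$, $x\in\mathbb R^d$ satisfies $\mu(B_{2^{-n-1}}(x))>0$, and $m$ is an integer with $$m\ \ge\ f_n(q,k)+a(q,k)\log\frac{\mu(B_{2^{-n}}(x))}{\mu(B_{2^{-n-1}}(x))},$$ there are pairwise disjoint balls $B_{2^{-n-m}}(x_i)\subset B_{2^{-n}}(x)$, $i=1,\dots,N$, with $N\ge2^{m(\tau'(q)q-\tau(q)-b(q,k))}$, such that for every $i$ $$2^{-m(\tau'(q)+1/k)}\le\frac{\mu(B_{2^{-n-m}}(x_i))}{\mu(B_{2^{-n}}(x))}\le2^{-m(\tau'(q)-1/k)},$$ $$\mu(B_{2^{-n-m-1}}(x_i))>0\quad\text{and}\quad\frac{\mu(B_{2^{-n-m+1}}(x_i))}{\mu(B_{2^{-n-m-1}}(x_i))}\le f_{n+m}(q,k).$$ **Theorem 2.1.** The limits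 $\alpha_{\min}=\lim_{q\to+\infty}\tau(q)/q\in[0,\infty)$ and $\alpha_{\max}=\lim_{q\to-\infty}\tau(q)/q\in[-\infty,+\infty]$ and the (finite) right derivative $\tau'(0+)$ of $\tau$ at $0$ exist, and the following hold. (a) If $\mu$ has an asymptotically good multifractal structure over $\mathbb R$, then for $\alpha\in\mathbb R$ we have $E(\alpha)\ne\emptyset$ if and only if $\alpha\in[\alpha_{\min},\alpha_{\max}]\cap\mathbb R$; and for every such $\alpha$, $\dim_HE(\alpha)=\tau^*(\alpha)$. (b) If $\mu$ has an asymptotically good multifractal structure over $\mathbb R_+$, then for every $\alpha\in[\alpha_{\min},\tau'(0+)]$ we have $E(\alpha)\ne\emptyset$ and $\dim_HE(\alpha)=\tau^*(\alpha)$. -/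

import Mathlib

open MeasureTheory Filter Topology Set Metric
open scoped ENNReal

noncomputable section

namespace Multifractal

variable {d : ℕ}

/-- `Θ_μ(q; r)`: the supremum of `∑ μ(B_r(x_i))^q` over all families of pairwise disjoint closed
balls `B_r(x_i)` centred in the support of `μ`. Disjoint balls have distinct centres, so a family is
given by its set of centres; as the terms are non-negative, finite families suffice. -/
def packingSum (μ : Measure (EuclideanSpace ℝ (Fin d))) (q r : ℝ) : ℝ≥0∞ :=
  ⨆ (F : Finset (EuclideanSpace ℝ (Fin d)))
    (_ : (F : Set (EuclideanSpace ℝ (Fin d))) ⊆ μ.support)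
    (_ : (F : Set (EuclideanSpace ℝ (Fin d))).PairwiseDisjoint (fun x => closedBall x r)),
    ∑ x ∈ F, μ (closedBall x r) ^ q

/-- The `L^q` spectrum `liminf_{r → 0+} log Θ_μ(q; r) / log r`, with values in `[-∞, ∞]`
(`ENNReal.log` is the natural logarithm with `log 0 = -∞` and `log ∞ = ∞`). -/
def lqSpectrum (μ : Measure (EuclideanSpace ℝ (Fin d))) (q : ℝ) : EReal :=
  liminf (fun r : ℝ => ENNReal.log (packingSum μ q r) / (Real.log r : EReal)) (𝓝[>] (0 : ℝ))

/-- The `L^q` spectrum as a real function; only meaningful where `lqSpectrum μ q` is finite. -/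
def tau (μ : Measure (EuclideanSpace ℝ (Fin d))) (q : ℝ) : ℝ :=
  (lqSpectrum μ q).toReal

/-- The level set `E_μ(α)` of the points where the local dimension
`lim_{r → 0+} log μ(B_r(x)) / log r` exists and equals the real number `α`. Outside the support the
quotient is eventually `(-∞) / log r = +∞`, so such points are in no level set. -/
def levelSet (μ : Measure (EuclideanSpace ℝ (Fin d))) (α : ℝ) : Set (EuclideanSpace ℝ (Fin d)) :=
  {x | Tendsto (fun r : ℝ => ENNReal.log (μ (closedBall x r)) / (Real.log r : EReal))
    (𝓝[>] (0 : ℝ)) (𝓝 (α : EReal))}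

/-- The Legendre transform `τ*(α) = inf {α q - τ(q) : q ∈ ℝ}`, with values in `[-∞, ∞]`. -/
def legendre (μ : Measure (EuclideanSpace ℝ (Fin d))) (α : ℝ) : EReal :=
  ⨅ q : ℝ, ((α * q : ℝ) : EReal) - lqSpectrum μ q

/-- The local box-counting principle at `q`, with numbers `a k`, `b k`, `f k n` for `k ≥ 1`, `n ≥ 0`.
The finset `F` is the set of centres of the disjoint balls, so that `F.card` is their number. -/
def LocalBoxCounting (μ : Measure (EuclideanSpace ℝ (Fin d))) (q : ℝ) : Prop :=
  ∃ (a b : ℕ → ℝ) (f : ℕ → ℕ → ℝ),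
    (∀ k, 1 ≤ k → 0 < a k ∧ 0 < b k ∧ ∀ n, 0 < f k n) ∧
    Tendsto b atTop (𝓝 0) ∧
    (∀ k, 1 ≤ k → Tendsto (fun n : ℕ => f k n / n) atTop (𝓝 0)) ∧
    ∀ k, 1 ≤ k → ∀ (n : ℕ) (x : EuclideanSpace ℝ (Fin d)),
      0 < μ.real (closedBall x (2 ^ (-(n : ℤ) - 1))) →
      ∀ m : ℕ,
        f k n + a k * Real.log (μ.real (closedBall x (2 ^ (-(n : ℤ)))) /
          μ.real (closedBall x (2 ^ (-(n : ℤ) - 1)))) ≤ m →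
        ∃ F : Finset (EuclideanSpace ℝ (Fin d)),
          (F : Set (EuclideanSpace ℝ (Fin d))).PairwiseDisjoint
            (fun y => closedBall y (2 ^ (-(n : ℤ) - m))) ∧
          (2 : ℝ) ^ ((m : ℝ) * (deriv (tau μ) q * q - tau μ q - b k)) ≤ F.card ∧
          ∀ y ∈ F,
            closedBall y (2 ^ (-(n : ℤ) - m)) ⊆ closedBall x (2 ^ (-(n : ℤ))) ∧
            (2 : ℝ) ^ (-(m : ℝ) * (deriv (tau μ) q + 1 / k)) ≤
              μ.real (closedBall y (2 ^ (-(n : ℤ) - m))) / μ.real (closedBall x (2 ^ (-(n : ℤ)))) ∧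
            μ.real (closedBall y (2 ^ (-(n : ℤ) - m))) / μ.real (closedBall x (2 ^ (-(n : ℤ)))) ≤
              (2 : ℝ) ^ (-(m : ℝ) * (deriv (tau μ) q - 1 / k)) ∧
            0 < μ.real (closedBall y (2 ^ (-(n : ℤ) - m - 1))) ∧
            μ.real (closedBall y (2 ^ (-(n : ℤ) - m + 1))) /
              μ.real (closedBall y (2 ^ (-(n : ℤ) - m - 1))) ≤ f k (n + m)

/-- `μ` has an asymptotically good multifractal structure over `I` (used with `I = ℝ` and
`I = (0, ∞)`): the local box-counting principle holds at all points of some set that is dense in the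
set of the points of `I` at which `τ` is differentiable. -/
def HasGoodStructure (μ : Measure (EuclideanSpace ℝ (Fin d))) (I : Set ℝ) : Prop :=
  ∃ Λ : Set ℝ, Λ ⊆ {q ∈ I | DifferentiableAt ℝ (tau μ) q} ∧
    {q ∈ I | DifferentiableAt ℝ (tau μ) q} ⊆ closure Λ ∧
    ∀ q ∈ Λ, LocalBoxCounting μ q

end Multifractal

end

open Multifractal

/-!
The `L^q` spectrum `τ` is concave and non-decreasing, because `Θ(q; r)` is log-convex in `q` and, up
to constants, non-increasing (`concaveOn_tau`, `monotone_tau`). The existence of the limits of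
`τ(q) / q` and of the right derivative at `0` follows from this alone.

The upper bound needs no structure: if the balls `B_r(x)` of a packing have measure about `r ^ α`, then
each contributes about `r ^ (α q)` to `Θ(q; r) ≤ r ^ (τ(q) - ε)`, so that there are at most
`r ^ (-(α q - τ(q)) - ε)` of them. Hence `dim_H E(α) ≤ α q - τ(q)` for all `q`
(`dimH_levelSet_le`), and `E(α)` is empty if one of these numbers is negative
(`nonneg_of_levelSet_nonempty`).

For the lower bound the local box-counting principle is iterated. The number of levels consumed by a
step from level `n` is `o(n)`, because the balls produced by a step are doubling up to a constant
that grows subexponentially. A diagonal argument (`exists_isSchedule`) makes all the parameters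
functions of the level alone while the errors still tend to zero. The steps may use different points
`q` of `Λ`. Using a slope `τ'(q₁)` above `α` whenever the accumulated exponent of the measure is below
`α` times the level, and a slope `τ'(q₂)` below `α` otherwise (`exists_levels`), gives a tree of
disjoint balls whose limit points have local dimension exactly `α`, and the mass distribution principle
(`IsTree.le_dimH_limitSet`) gives the dimension of the set of limit points. This yields
`le_dimH_levelSet_of_localBoxCounting`, a lower bound `s` whenever `(α, s)` is approximated by convex
combinations of points `(τ'(q), q τ'(q) - τ(q))` with `q` in `Λ`. The mixing of two slopes is what
covers the `α` in the gap between the one-sided derivatives at a point where `τ` has a corner.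

For `α` between `αmin` and `αmax` (or `τ'(0+)`) either `α` is the slope of a supporting line of `τ`,
at `q` say, and the infimum `τ*(α)` is attained at `q` and approximated from both sides of `q`
(`exists_near_supporting_slope`); or `α` is a limit of slopes at an end of the interval of `q`'s, where
`q τ'(q) - τ(q)` is bounded below by `τ*(α)` up to `o(1)` (`multifractal_of_tendsto_deriv`).
-/

namespace Multifractal

/-! ### Concavity and monotonicity of the `L^q` spectrum -/

section Spectrum

variable {d : ℕ} {μ : Measure (EuclideanSpace ℝ (Fin d))}

theorem le_log_div_log_iff (Θ : ℝ≥0∞) {r : ℝ} (hr : 0 < r) (hr1 : r < 1) (T : ℝ) :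
    (T : EReal) ≤ ENNReal.log Θ / (Real.log r : EReal) ↔ Θ ≤ ENNReal.ofReal (r ^ T) := by
  have hlog : Real.log r < 0 := Real.log_neg hr hr1
  have h1 : (T : EReal) = ENNReal.log (ENNReal.ofReal (r ^ T)) / (Real.log r : EReal) := by
    rw [ENNReal.log_ofReal_of_pos (Real.rpow_pos_of_pos hr T), Real.log_rpow hr, ← EReal.coe_div,
      mul_div_cancel_right₀ _ hlog.ne]
  rw [h1, (EReal.strictAnti_div_right_of_neg (b := (Real.log r : EReal))
    (by exact_mod_cast hlog) (EReal.coe_ne_bot _)).le_iff_ge, ENNReal.log_le_log_iff]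

theorem eventually_Ioo_zero_one : ∀ᶠ r : ℝ in 𝓝[>] (0 : ℝ), r ∈ Ioo (0 : ℝ) 1 :=
  Ioo_mem_nhdsGT one_pos

theorem le_lqSpectrum_of_eventually {q T : ℝ}
    (h : ∀ᶠ r : ℝ in 𝓝[>] (0 : ℝ), packingSum μ q r ≤ ENNReal.ofReal (r ^ T)) :
    (T : EReal) ≤ lqSpectrum μ q := by
  refine le_liminf_of_le (by isBoundedDefault) ?_
  filter_upwards [h, eventually_Ioo_zero_one] with r hr h01
  exact (le_log_div_log_iff _ h01.1 h01.2 T).2 hr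

theorem eventually_packingSum_le {q T : ℝ} (h : (T : EReal) < lqSpectrum μ q) :
    ∀ᶠ r : ℝ in 𝓝[>] (0 : ℝ), packingSum μ q r ≤ ENNReal.ofReal (r ^ T) := by
  filter_upwards [eventually_lt_of_lt_liminf h, eventually_Ioo_zero_one] with r hr h01
  exact (le_log_div_log_iff _ h01.1 h01.2 T).1 hr.le

theorem coe_tau {q : ℝ} (h : lqSpectrum μ q ≠ ⊥ ∧ lqSpectrum μ q ≠ ⊤) :
    ((tau μ q : ℝ) : EReal) = lqSpectrum μ q :=
  EReal.coe_toReal h.2 h.1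

theorem measure_closedBall_pos {x : EuclideanSpace ℝ (Fin d)} (hx : x ∈ μ.support) {r : ℝ}
    (hr : 0 < r) : 0 < μ (closedBall x r) :=
  (Measure.mem_support_iff_forall x).1 hx _ (closedBall_mem_nhds x hr)

theorem packingSum_convexComb_le [IsFiniteMeasure μ] {p q a b r : ℝ} (ha : 0 < a) (hb : 0 < b)
    (hab : a + b = 1) (hr : 0 < r) :
    packingSum μ (a * p + b * q) r ≤ packingSum μ p r ^ a * packingSum μ q r ^ b := by
  refine iSup_le fun F => iSup_le fun hF => iSup_le fun hdis => ?_
  have hle : ∀ t : ℝ, ∑ x ∈ F, μ (closedBall x r) ^ t ≤ packingSum μ t r := fun t =>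
    le_iSup_of_le F (le_iSup_of_le hF (le_iSup_of_le hdis le_rfl))
  have hconj : Real.HolderConjugate a⁻¹ b⁻¹ := by
    rw [Real.holderConjugate_iff]
    refine ⟨(one_lt_inv₀ ha).2 (by linarith), by simpa using hab⟩
  calc ∑ x ∈ F, μ (closedBall x r) ^ (a * p + b * q)
      = ∑ x ∈ F, (μ (closedBall x r) ^ (a * p)) * (μ (closedBall x r) ^ (b * q)) := by
        refine Finset.sum_congr rfl fun x hx => ?_
        exact ENNReal.rpow_add _ _ (measure_closedBall_pos (hF hx) hr).ne' (measure_ne_top _ _)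
    _ ≤ (∑ x ∈ F, (μ (closedBall x r) ^ (a * p)) ^ a⁻¹) ^ (1 / a⁻¹) *
        (∑ x ∈ F, (μ (closedBall x r) ^ (b * q)) ^ b⁻¹) ^ (1 / b⁻¹) :=
        ENNReal.inner_le_Lp_mul_Lq F _ _ hconj
    _ = (∑ x ∈ F, μ (closedBall x r) ^ p) ^ a * (∑ x ∈ F, μ (closedBall x r) ^ q) ^ b := by
        have h1 : a * p * a⁻¹ = p := by field_simp
        have h2 : b * q * b⁻¹ = q := by field_simp
        simp only [← ENNReal.rpow_mul, one_div, inv_inv, h1, h2]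
    _ ≤ _ := by gcongr <;> exact hle _

theorem packingSum_le_of_le [IsFiniteMeasure μ] {p q r : ℝ} (hpq : p ≤ q) (hr : 0 < r) :
    packingSum μ q r ≤ μ univ ^ (q - p) * packingSum μ p r := by
  refine iSup_le fun F => iSup_le fun hF => iSup_le fun hdis => ?_
  calc ∑ x ∈ F, μ (closedBall x r) ^ q
      ≤ ∑ x ∈ F, μ univ ^ (q - p) * μ (closedBall x r) ^ p := by
        refine Finset.sum_le_sum fun x hx => ?_
        have : q = (q - p) + p := by ring
        conv_lhs => rw [this, ENNReal.rpow_add _ _ (measure_closedBall_pos (hF hx) hr).ne'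
          (measure_ne_top _ _)]
        exact mul_le_mul' (ENNReal.rpow_le_rpow (measure_mono (subset_univ _)) (by linarith)) le_rfl
    _ = μ univ ^ (q - p) * ∑ x ∈ F, μ (closedBall x r) ^ p := by rw [Finset.mul_sum]
    _ ≤ _ := by
        gcongr
        exact le_iSup_of_le F (le_iSup_of_le hF (le_iSup_of_le hdis le_rfl))

theorem le_tau_of_eventually {q T : ℝ} (h : lqSpectrum μ q ≠ ⊥ ∧ lqSpectrum μ q ≠ ⊤)
    (hT : ∀ᶠ r : ℝ in 𝓝[>] (0 : ℝ), packingSum μ q r ≤ ENNReal.ofReal (r ^ T)) :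
    T ≤ tau μ q := by
  have := le_lqSpectrum_of_eventually hT
  rw [← coe_tau h] at this
  exact_mod_cast this

theorem eventually_packingSum_le_of_lt_tau {q T : ℝ}
    (h : lqSpectrum μ q ≠ ⊥ ∧ lqSpectrum μ q ≠ ⊤) (hT : T < tau μ q) :
    ∀ᶠ r : ℝ in 𝓝[>] (0 : ℝ), packingSum μ q r ≤ ENNReal.ofReal (r ^ T) := by
  apply eventually_packingSum_le
  rw [← coe_tau h]
  exact_mod_cast hT

theorem concaveOn_tau [IsFiniteMeasure μ]
    (hfin : ∀ q : ℝ, lqSpectrum μ q ≠ ⊥ ∧ lqSpectrum μ q ≠ ⊤) :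
    ConcaveOn ℝ univ (tau μ) := by
  rw [concaveOn_iff_forall_pos]
  refine ⟨convex_univ, fun p _ q _ a b ha hb hab => ?_⟩
  simp only [smul_eq_mul]
  refine le_of_forall_pos_sub_le fun ε hε => ?_
  apply le_tau_of_eventually (hfin _)
  filter_upwards [eventually_packingSum_le_of_lt_tau (hfin p) (sub_lt_self (tau μ p) hε),
    eventually_packingSum_le_of_lt_tau (hfin q) (sub_lt_self (tau μ q) hε),
    self_mem_nhdsWithin] with r hp hq (hr : 0 < r)
  calc packingSum μ (a * p + b * q) r ≤ packingSum μ p r ^ a * packingSum μ q r ^ b :=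
        packingSum_convexComb_le ha hb hab hr
    _ ≤ ENNReal.ofReal (r ^ (tau μ p - ε)) ^ a * ENNReal.ofReal (r ^ (tau μ q - ε)) ^ b := by
        gcongr
    _ = ENNReal.ofReal (r ^ (a * tau μ p + b * tau μ q - ε)) := by
        rw [ENNReal.ofReal_rpow_of_pos (by positivity), ENNReal.ofReal_rpow_of_pos (by positivity),
          ← ENNReal.ofReal_mul (by positivity), ← Real.rpow_mul hr.le, ← Real.rpow_mul hr.le,
          ← Real.rpow_add hr]
        congr 2
        linear_combination (-ε) * hab

theorem monotone_tau [IsFiniteMeasure μ]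
    (hfin : ∀ q : ℝ, lqSpectrum μ q ≠ ⊥ ∧ lqSpectrum μ q ≠ ⊤) : Monotone (tau μ) := by
  intro p q hpq
  refine le_of_forall_pos_sub_le fun ε hε => ?_
  apply le_tau_of_eventually (hfin _)
  have hC : μ univ ^ (q - p) ≠ ⊤ := ENNReal.rpow_ne_top_of_nonneg (by linarith) (measure_ne_top _ _)
  -- the constant factor is absorbed in `r ^ (-ε / 2)`, which tends to infinity
  have hlim : Tendsto (fun r : ℝ => r ^ (-(ε / 2))) (𝓝[>] 0) atTop :=
    tendsto_rpow_neg_nhdsGT_zero (by linarith)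
  filter_upwards [eventually_packingSum_le_of_lt_tau (hfin p) (sub_lt_self (tau μ p) (half_pos hε)),
    hlim.eventually_ge_atTop (μ univ ^ (q - p)).toReal,
    self_mem_nhdsWithin] with r hp hc (hr : 0 < r)
  calc packingSum μ q r ≤ μ univ ^ (q - p) * packingSum μ p r := packingSum_le_of_le hpq hr
    _ ≤ ENNReal.ofReal (r ^ (-(ε / 2))) * ENNReal.ofReal (r ^ (tau μ p - ε / 2)) := by
        gcongr
        exact (ENNReal.le_ofReal_iff_toReal_le hC (by positivity)).2 hc
    _ = ENNReal.ofReal (r ^ (tau μ p - ε)) := by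
        rw [← ENNReal.ofReal_mul (by positivity), ← Real.rpow_add hr]
        congr 2
        ring

end Spectrum

/-! ### Limits of slopes of a concave function -/

section Concave

variable {T : ℝ → ℝ}

theorem le_add_deriv_mul (hT : ConcaveOn ℝ univ T) {q : ℝ} (hq : DifferentiableAt ℝ T q) (p : ℝ) :
    T p ≤ T q + deriv T q * (p - q) := by
  rcases lt_trichotomy p q with h | rfl | h
  · have := hT.deriv_le_slope (mem_univ p) (mem_univ q) h hq
    rw [slope_def_field, le_div_iff₀ (by linarith)] at this
    linarith
  · simp
  · have := hT.slope_le_deriv (mem_univ q) (mem_univ p) h hq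
    rw [slope_def_field, div_le_iff₀ (by linarith)] at this
    linarith

theorem exists_tendsto_div_atTop (hT : ConcaveOn ℝ univ T) (hmono : Monotone T) :
    ∃ a : ℝ, 0 ≤ a ∧ Tendsto (fun q => T q / q) atTop (𝓝 a) := by
  have hanti : Antitone fun q : ℝ => slope T 0 (max q 1) := by
    intro p q hpq
    have hp : (0 : ℝ) < max p 1 := lt_max_of_lt_right one_pos
    have hq : (0 : ℝ) < max q 1 := lt_max_of_lt_right one_pos
    exact hT.slope_anti (mem_univ 0) ⟨mem_univ _, hp.ne'⟩ ⟨mem_univ _, hq.ne'⟩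
      (max_le_max_right 1 hpq)
  have hnn : ∀ q : ℝ, 0 ≤ slope T 0 (max q 1) := fun q => by
    have hq : (0 : ℝ) < max q 1 := lt_max_of_lt_right one_pos
    rw [slope_def_field]
    exact div_nonneg (sub_nonneg.2 (hmono hq.le)) (by linarith)
  refine ⟨⨅ q : ℝ, slope T 0 (max q 1), le_ciInf hnn, ?_⟩
  have h1 := tendsto_atTop_ciInf hanti ⟨0, by rintro _ ⟨q, rfl⟩; exact hnn q⟩
  have h2 : Tendsto (fun q : ℝ => T 0 / q) atTop (𝓝 0) := tendsto_const_nhds.div_atTop tendsto_id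
  have h3 := h1.add h2
  rw [add_zero] at h3
  refine h3.congr' ?_
  filter_upwards [eventually_ge_atTop (1 : ℝ)] with q hq
  rw [max_eq_left hq, slope_def_field]
  have : q ≠ 0 := by linarith
  field_simp
  ring

theorem exists_tendsto_div_atBot (hT : ConcaveOn ℝ univ T) :
    ∃ a : EReal, Tendsto (fun q : ℝ => ((T q / q : ℝ) : EReal)) atBot (𝓝 a) := by
  have hanti : Antitone fun q : ℝ => ((slope T 0 (min q (-1)) : ℝ) : EReal) := by
    intro p q hpq
    have hp : min p (-1) < (0 : ℝ) := min_lt_of_right_lt (by norm_num)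
    have hq : min q (-1) < (0 : ℝ) := min_lt_of_right_lt (by norm_num)
    exact EReal.coe_le_coe_iff.2 <| hT.slope_anti (mem_univ 0) ⟨mem_univ _, hp.ne⟩
      ⟨mem_univ _, hq.ne⟩ (min_le_min_right (-1) hpq)
  have h1 := tendsto_atBot_iSup hanti
  have h2 : Tendsto (fun q : ℝ => ((T 0 / q : ℝ) : EReal)) atBot (𝓝 ((0 : ℝ) : EReal)) :=
    EReal.tendsto_coe.2 (tendsto_const_nhds.div_atBot tendsto_id)
  refine ⟨_, ((EReal.continuousAt_add (p := (_, ((0 : ℝ) : EReal))) (Or.inr (EReal.coe_ne_bot 0))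
    (Or.inr (EReal.coe_ne_top 0))).tendsto.comp (h1.prodMk_nhds h2)).congr' ?_⟩
  filter_upwards [eventually_le_atBot (-1 : ℝ)] with q hq
  simp only [Function.comp_apply]
  rw [min_eq_left hq, slope_def_field, ← EReal.coe_add]
  have : q ≠ 0 := by linarith
  congr 1
  field_simp
  ring

/-- The slopes of a concave function approach, at `+∞`, the limit of `T q / q` from above. -/
theorem eventually_deriv_le (hT : ConcaveOn ℝ univ T) {a ε : ℝ} (hε : 0 < ε)
    (ha : Tendsto (fun q => T q / q) atTop (𝓝 a)) :
    ∀ᶠ q in atTop, DifferentiableAt ℝ T q → deriv T q ≤ a + ε := by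
  have h2 : Tendsto (fun q : ℝ => T 0 / q) atTop (𝓝 0) := tendsto_const_nhds.div_atTop tendsto_id
  have h3 := ha.sub h2
  rw [sub_zero] at h3
  filter_upwards [h3.eventually_lt_const (lt_add_of_pos_right a hε), eventually_gt_atTop 0]
    with q hq h0 hd
  have := le_add_deriv_mul hT hd 0
  refine le_trans ?_ hq.le
  rw [← sub_div, le_div_iff₀ h0]
  linarith

/-- The slopes of a concave function approach, at `-∞`, the limit of `T q / q` from below. -/
theorem eventually_le_deriv (hT : ConcaveOn ℝ univ T) {a : EReal} {b c : ℝ} (hb : (b : EReal) ≤ a)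
    (hcb : c < b) (ha : Tendsto (fun q : ℝ => ((T q / q : ℝ) : EReal)) atBot (𝓝 a)) :
    ∀ᶠ q in atBot, DifferentiableAt ℝ T q → c ≤ deriv T q := by
  have h2 : Tendsto (fun q : ℝ => T 0 / q) atBot (𝓝 0) := tendsto_const_nhds.div_atBot tendsto_id
  have hm : (((b + c) / 2 : ℝ) : EReal) < a :=
    lt_of_lt_of_le (EReal.coe_lt_coe_iff.2 (by linarith)) hb
  filter_upwards [ha.eventually_const_lt hm, h2.eventually_lt_const (show 0 < (b - c) / 2 by linarith),
    eventually_lt_atBot 0] with q hq hq2 h0 hd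
  rw [EReal.coe_lt_coe_iff] at hq
  have h4 : c ≤ (T q - T 0) / q := by rw [sub_div]; linarith
  rw [le_div_iff_of_neg h0] at h4
  have := le_add_deriv_mul hT hd 0
  nlinarith

theorem eventually_le_deriv_nhdsGT (hT : ConcaveOn ℝ univ T) (hc : Continuous T) {δ ε q₀ : ℝ}
    (hε : 0 < ε) (hδ : HasDerivWithinAt T δ (Ioi q₀) q₀) :
    ∀ᶠ q in 𝓝[>] q₀, DifferentiableAt ℝ T q → δ - ε ≤ deriv T q := by
  rw [hasDerivWithinAt_iff_tendsto_slope' self_notMem_Ioi] at hδ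
  obtain ⟨p, hp, hp0⟩ := ((hδ.eventually_const_lt (sub_lt_self δ hε)).and
    self_mem_nhdsWithin).exists
  have hp0 : q₀ < p := hp0
  rw [slope_def_field] at hp
  have hcont : Tendsto (fun q => (T p - T q) / (p - q)) (𝓝[>] q₀) (𝓝 ((T p - T q₀) / (p - q₀))) := by
    refine Tendsto.mono_left ?_ nhdsWithin_le_nhds
    exact (tendsto_const_nhds.sub hc.continuousAt).div (tendsto_const_nhds.sub tendsto_id)
      (by simpa using (sub_pos.2 hp0).ne')
  filter_upwards [hcont.eventually_const_lt hp, Ioo_mem_nhdsGT hp0] with q hq hqI hd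
  have := le_add_deriv_mul hT hd p
  have h1 : (T p - T q) / (p - q) ≤ deriv T q := by
    rw [div_le_iff₀ (by linarith [hqI.2])]; linarith
  linarith

theorem dense_differentiableAt (hmono : Monotone T) : Dense {q | DifferentiableAt ℝ T q} :=
  Measure.dense_of_ae (μ := volume) hmono.ae_differentiableAt

theorem exists_mem_of_isOpen (hmono : Monotone T) {I Λ U : Set ℝ} (hI : IsOpen I)
    (hdense : {q ∈ I | DifferentiableAt ℝ T q} ⊆ closure Λ) (hU : IsOpen U)
    (hne : (U ∩ I).Nonempty) : ∃ p ∈ Λ, p ∈ U := by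
  obtain ⟨p, hp, hpd⟩ := (dense_differentiableAt hmono).inter_open_nonempty _ (hU.inter hI) hne
  obtain ⟨p', hp', hp'Λ⟩ := mem_closure_iff.1 (hdense ⟨hp.2, hpd⟩) U hU hp.1
  exact ⟨p', hp'Λ, hp'⟩

/-- If the derivative takes values on both sides of `α`, some point has a supporting line of
slope `α`. -/
theorem exists_supporting_slope (hT : ConcaveOn ℝ univ T) (hc : Continuous T) {I : Set ℝ}
    (hI : I.OrdConnected) {α q₁ q₂ : ℝ} (hq₁ : q₁ ∈ I) (hq₂ : q₂ ∈ I)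
    (hd₁ : DifferentiableAt ℝ T q₁) (hd₂ : DifferentiableAt ℝ T q₂) (h₁ : α ≤ deriv T q₁)
    (h₂ : deriv T q₂ ≤ α) : ∃ q ∈ I, ∀ p, T p ≤ T q + α * (p - q) := by
  have left : ∀ p ≤ q₁, T p ≤ T q₁ + α * (p - q₁) := fun p hp => by
    have := le_add_deriv_mul hT hd₁ p
    nlinarith
  have right : ∀ p, q₂ ≤ p → T p ≤ T q₂ + α * (p - q₂) := fun p hp => by
    have := le_add_deriv_mul hT hd₂ p
    nlinarith
  rcases le_total q₁ q₂ with h | h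
  · obtain ⟨q, hq, hmax⟩ := isCompact_Icc.exists_isMaxOn (nonempty_Icc.2 h)
      (f := fun p => T p - α * p) (by fun_prop)
    have hmax' : ∀ p ∈ Icc q₁ q₂, T p - α * p ≤ T q - α * q := fun p hp => hmax hp
    refine ⟨q, hI.out hq₁ hq₂ hq, fun p => ?_⟩
    rcases le_total p q₁ with hp | hp
    · have := left p hp
      have := hmax' q₁ (left_mem_Icc.2 h)
      linarith
    rcases le_total q₂ p with hp' | hp'
    · have := right p hp'
      have := hmax' q₂ (right_mem_Icc.2 h)
      linarith
    · have := hmax' p ⟨hp, hp'⟩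
      linarith
  · refine ⟨q₁, hq₁, fun p => ?_⟩
    rcases le_total p q₁ with hp | hp
    · exact left p hp
    · have := right p (h.trans hp)
      have := left q₂ h
      linarith

/-- Near a point `q` with a supporting line of slope `α` there are, on either side, points `p` of a
given dense set at which the derivative lies on the corresponding side of `α` and at which the
value `p T'(p) - T(p)` of the Legendre transform is almost on the line of slope `q` through
`(α, q α - T(q))`. -/
theorem exists_near_supporting_slope (hT : ConcaveOn ℝ univ T) (hc : Continuous T)
    (hmono : Monotone T) {I Λ : Set ℝ} (hI : IsOpen I)
    (hΛ : Λ ⊆ {q ∈ I | DifferentiableAt ℝ T q})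
    (hdense : {q ∈ I | DifferentiableAt ℝ T q} ⊆ closure Λ) {α q ε : ℝ} (hqI : q ∈ I)
    (hq : ∀ p, T p ≤ T q + α * (p - q)) (hε : 0 < ε) :
    ∃ q₁ ∈ Λ, ∃ q₂ ∈ Λ, α ≤ deriv T q₁ ∧ deriv T q₂ ≤ α ∧
      α * q - T q + q * (deriv T q₁ - α) - ε ≤ deriv T q₁ * q₁ - T q₁ ∧
      α * q - T q + q * (deriv T q₂ - α) - ε ≤ deriv T q₂ * q₂ - T q₂ := by
  have hmem : ∀ U : Set ℝ, IsOpen U → (U ∩ I).Nonempty → ∃ p ∈ Λ, p ∈ U := fun U hU hne =>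
    exists_mem_of_isOpen hmono hI hdense hU hne
  have hIn : I ∈ 𝓝 q := hI.mem_nhds hqI
  set C := T q - T (q - 2) with hC
  have hC0 : 0 ≤ C := sub_nonneg.2 (hmono (by linarith))
  obtain ⟨η, hη, hηε⟩ : ∃ η > 0, ∀ p, |p - q| < η → |T p - T q| < ε := by
    have := Metric.continuous_iff.1 hc q ε hε
    simpa [Real.dist_eq] using this
  have hη' : 0 < min (min η 1) (ε / (C + 1)) := by positivity
  obtain ⟨q₁, h1Λ, h1⟩ := hmem (Ioo (q - min (min η 1) (ε / (C + 1))) q) isOpen_Ioo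
    (nonempty_of_mem (inter_mem (Ioo_mem_nhdsLT (by linarith)) (mem_nhdsWithin_of_mem_nhds hIn)))
  obtain ⟨q₂, h2Λ, h2⟩ := hmem (Ioo q (q + min (min η 1) (ε / (C + 1)))) isOpen_Ioo
    (nonempty_of_mem (inter_mem (Ioo_mem_nhdsGT (by linarith)) (mem_nhdsWithin_of_mem_nhds hIn)))
  have e1 : min (min η 1) (ε / (C + 1)) ≤ η := (min_le_left _ _).trans (min_le_left _ _)
  have e2 : min (min η 1) (ε / (C + 1)) ≤ 1 := (min_le_left _ _).trans (min_le_right _ _)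
  have e3 : min (min η 1) (ε / (C + 1)) ≤ ε / (C + 1) := min_le_right _ _
  generalize min (min η 1) (ε / (C + 1)) = θ at *
  have hd1 := (hΛ h1Λ).2
  have hd2 := (hΛ h2Λ).2
  obtain ⟨h1l, h1r⟩ := h1
  obtain ⟨h2l, h2r⟩ := h2
  have t1 := le_add_deriv_mul hT hd1 q
  have t2 := le_add_deriv_mul hT hd2 q
  have s1 := hq q₁
  have s2 := hq q₂
  have hT2 : 0 ≤ deriv T q₂ := hmono.deriv_nonneg
  refine ⟨q₁, h1Λ, q₂, h2Λ, ?_, ?_, ?_, ?_⟩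
  · by_contra! h
    nlinarith
  · by_contra! h
    nlinarith
  · have hmon : T q₁ ≤ T q := hmono h1r.le
    have hDC : deriv T q₁ ≤ C := by
      have := le_add_deriv_mul hT hd1 (q - 2)
      by_contra! h
      nlinarith
    have hD0 : 0 ≤ deriv T q₁ := hmono.deriv_nonneg
    have : (q - q₁) * (C + 1) ≤ ε := by
      rw [← le_div_iff₀ (by linarith)]
      linarith
    nlinarith
  · have := (abs_lt.1 (hηε q₂ (abs_lt.2 ⟨by linarith, by linarith⟩))).2
    nlinarith

end Concave

/-! ### The upper bound for the dimension of level sets -/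

section UpperBound

variable {d : ℕ} {μ : Measure (EuclideanSpace ℝ (Fin d))}

theorem measureReal_closedBall_pos [IsFiniteMeasure μ] {x : EuclideanSpace ℝ (Fin d)}
    (hx : x ∈ μ.support) {r : ℝ} (hr : 0 < r) : 0 < μ.real (closedBall x r) :=
  ENNReal.toReal_pos (measure_closedBall_pos hx hr).ne' (measure_ne_top _ _)

/-- Membership in a level set in terms of real logarithms. -/
theorem mem_levelSet_iff [IsFiniteMeasure μ] {x : EuclideanSpace ℝ (Fin d)} {α : ℝ} :
    x ∈ levelSet μ α ↔ x ∈ μ.support ∧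
      Tendsto (fun r : ℝ => Real.log (μ.real (closedBall x r)) / Real.log r) (𝓝[>] (0 : ℝ))
        (𝓝 α) := by
  by_cases hx : x ∈ μ.support
  · simp only [hx, true_and]
    rw [levelSet, mem_ofPred_eq, ← EReal.tendsto_coe]
    apply tendsto_congr'
    filter_upwards [self_mem_nhdsWithin] with r (hr : 0 < r)
    rw [ENNReal.log_pos_real (measure_closedBall_pos hx hr).ne' (measure_ne_top _ _),
      ← EReal.coe_div]
    rfl
  · simp only [hx, false_and, iff_false]
    intro h
    obtain ⟨U, hU, hU0⟩ := Measure.notMem_support_iff_exists.1 hx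
    obtain ⟨ρ, hρ, hρU⟩ := Metric.nhds_basis_closedBall.mem_iff.1 hU
    have htop : Tendsto (fun r : ℝ => ENNReal.log (μ (closedBall x r)) / (Real.log r : EReal))
        (𝓝[>] (0 : ℝ)) (𝓝 ⊤) := by
      refine tendsto_const_nhds.congr' ?_
      filter_upwards [eventually_Ioo_zero_one, Ioo_mem_nhdsGT hρ] with r hr hr'
      have : μ (closedBall x r) = 0 :=
        measure_mono_null ((closedBall_subset_closedBall hr'.2.le).trans hρU) hU0
      rw [this, ENNReal.log_zero, EReal.bot_div_of_neg_ne_bot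
        (by exact_mod_cast Real.log_neg hr.1 hr.2) (EReal.coe_ne_bot _)]
    exact EReal.coe_ne_top α (tendsto_nhds_unique h htop)

theorem exists_cover_of_card_le {X : Type*} [MetricSpace X] {A : Set X} {r : ℝ} {C : ℕ} (hr : 0 ≤ r)
    (hC : ∀ F : Finset X, (F : Set X) ⊆ A →
      (F : Set X).PairwiseDisjoint (fun x => closedBall x r) → F.card ≤ C) :
    ∃ F : Finset X, (F : Set X) ⊆ A ∧ (F : Set X).PairwiseDisjoint (fun x => closedBall x r) ∧
      A ⊆ ⋃ y : F, closedBall (y : X) (2 * r) := by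
  classical
  -- a packing of maximal cardinality cannot be enlarged
  let P : ℕ → Prop := fun n => ∃ F : Finset X, (F : Set X) ⊆ A ∧
    (F : Set X).PairwiseDisjoint (fun x => closedBall x r) ∧ F.card = n
  have h0 : P 0 := ⟨∅, by simp⟩
  obtain ⟨F, hFA, hF, hcard⟩ : P (Nat.findGreatest P C) := Nat.findGreatest_spec (Nat.zero_le _) h0
  refine ⟨F, hFA, hF, fun x hx => ?_⟩
  by_contra hcov
  simp only [mem_iUnion, mem_closedBall, not_exists, not_le] at hcov
  have hxF : x ∉ F := fun hxF => by
    have := hcov ⟨x, hxF⟩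
    rw [dist_self] at this
    linarith
  have hins : P (F.card + 1) := by
    refine ⟨insert x F, ?_, ?_, Finset.card_insert_of_notMem hxF⟩
    · simpa [insert_subset_iff] using ⟨hx, hFA⟩
    · rw [Finset.coe_insert]
      refine hF.insert fun y hy _ => ?_
      rw [Set.disjoint_left]
      intro z hz hz'
      rw [mem_closedBall, dist_comm] at hz
      rw [mem_closedBall] at hz'
      have := dist_triangle x z y
      linarith [hcov ⟨y, hy⟩]
  have hle : F.card + 1 ≤ C := by
    obtain ⟨G, hGA, hG, hGc⟩ := hins
    exact hGc ▸ hC G hGA hG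
  have h1 := Nat.le_findGreatest hle hins
  omega

/-- The points at which the power bounds of exponents `α ± η` hold at all scales below `ρ`. -/
def powerBoundSet (μ : Measure (EuclideanSpace ℝ (Fin d))) (α η ρ : ℝ) :
    Set (EuclideanSpace ℝ (Fin d)) :=
  {x | x ∈ μ.support ∧ ∀ r ∈ Ioo (0 : ℝ) ρ,
    r ^ (α + η) ≤ μ.real (closedBall x r) ∧ μ.real (closedBall x r) ≤ r ^ (α - η)}

theorem levelSet_subset_iUnion [IsFiniteMeasure μ] {α η : ℝ} (hη : 0 < η) :
    levelSet μ α ⊆ ⋃ N : ℕ, powerBoundSet μ α η (1 / (N + 1)) := by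
  intro x hx
  obtain ⟨hxs, hlim⟩ := mem_levelSet_iff.1 hx
  have hev : ∀ᶠ r in 𝓝[>] (0 : ℝ),
      r ^ (α + η) ≤ μ.real (closedBall x r) ∧ μ.real (closedBall x r) ≤ r ^ (α - η) := by
    filter_upwards [hlim.eventually_const_lt (sub_lt_self α hη),
      hlim.eventually_lt_const (lt_add_of_pos_right α hη), eventually_Ioo_zero_one] with r h1 h2 hr
    have hl := Real.log_neg hr.1 hr.2
    have hpos := measureReal_closedBall_pos hxs hr.1
    rw [lt_div_iff_of_neg hl] at h1
    rw [div_lt_iff_of_neg hl] at h2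
    constructor
    · rw [← Real.log_le_log_iff (Real.rpow_pos_of_pos hr.1 _) hpos, Real.log_rpow hr.1]
      exact h2.le
    · rw [← Real.log_le_log_iff hpos (Real.rpow_pos_of_pos hr.1 _), Real.log_rpow hr.1]
      exact h1.le
  obtain ⟨ρ, hρ, hρs⟩ := mem_nhdsGT_iff_exists_Ioo_subset.1 hev
  obtain ⟨N, hN⟩ := exists_nat_one_div_lt (show (0 : ℝ) < ρ from hρ)
  exact mem_iUnion.2 ⟨N, hxs, fun r hr => hρs ⟨hr.1, hr.2.trans hN⟩⟩

theorem rpow_le_measure_rpow [IsFiniteMeasure μ] {α η ρ r : ℝ} (q : ℝ)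
    {x : EuclideanSpace ℝ (Fin d)} (hx : x ∈ powerBoundSet μ α η ρ) (hr : r ∈ Ioo (0 : ℝ) ρ) :
    ENNReal.ofReal (r ^ (α * q + |q| * η)) ≤ μ (closedBall x r) ^ q := by
  obtain ⟨h1, h2⟩ := hx.2 r hr
  have hpos := measureReal_closedBall_pos hx.1 hr.1
  rw [← ofReal_measureReal, ENNReal.ofReal_rpow_of_pos hpos]
  apply ENNReal.ofReal_le_ofReal
  rcases le_total 0 q with hq | hq
  · calc r ^ (α * q + |q| * η) = (r ^ (α + η)) ^ q := by
          rw [← Real.rpow_mul hr.1.le, abs_of_nonneg hq]; congr 1; ring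
      _ ≤ _ := Real.rpow_le_rpow (Real.rpow_nonneg hr.1.le _) h1 hq
  · calc r ^ (α * q + |q| * η) = (r ^ (α - η)) ^ q := by
          rw [← Real.rpow_mul hr.1.le, abs_of_nonpos hq]; congr 1; ring
      _ ≤ _ := Real.rpow_le_rpow_of_nonpos hpos h2 hq

theorem eventually_card_le [IsFiniteMeasure μ]
    (hfin : ∀ q : ℝ, lqSpectrum μ q ≠ ⊥ ∧ lqSpectrum μ q ≠ ⊤) (α q : ℝ) {η ρ : ℝ} (hη : 0 < η)
    (hρ : 0 < ρ) :
    ∀ᶠ r in 𝓝[>] (0 : ℝ), ∀ F : Finset (EuclideanSpace ℝ (Fin d)),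
      (F : Set (EuclideanSpace ℝ (Fin d))) ⊆ powerBoundSet μ α η ρ →
      (F : Set (EuclideanSpace ℝ (Fin d))).PairwiseDisjoint (fun x => closedBall x r) →
      (F.card : ℝ) ≤ r ^ (-(α * q - tau μ q + η * (1 + |q|))) := by
  filter_upwards [eventually_packingSum_le_of_lt_tau (hfin q) (sub_lt_self _ hη),
    Ioo_mem_nhdsGT hρ] with r hΘ hr F hFA hF
  have h1 : (F.card : ℝ≥0∞) * ENNReal.ofReal (r ^ (α * q + |q| * η)) ≤
      ENNReal.ofReal (r ^ (tau μ q - η)) := by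
    refine le_trans ?_ hΘ
    rw [← nsmul_eq_mul, ← Finset.sum_const]
    refine le_trans (Finset.sum_le_sum fun x hx => rpow_le_measure_rpow q (hFA hx) hr) ?_
    exact le_iSup_of_le F (le_iSup_of_le (fun x hx => (hFA hx).1) (le_iSup_of_le hF le_rfl))
  rw [← ENNReal.ofReal_natCast, ← ENNReal.ofReal_mul (Nat.cast_nonneg _),
    ENNReal.ofReal_le_ofReal_iff (Real.rpow_nonneg hr.1.le _)] at h1
  have hp := Real.rpow_pos_of_pos hr.1 (α * q + |q| * η)
  rw [← le_div_iff₀ hp, ← Real.rpow_sub hr.1] at h1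
  refine h1.trans_eq ?_
  congr 1
  ring

theorem nonneg_of_levelSet_nonempty [IsFiniteMeasure μ]
    (hfin : ∀ q : ℝ, lqSpectrum μ q ≠ ⊥ ∧ lqSpectrum μ q ≠ ⊤) {α : ℝ}
    (hne : (levelSet μ α).Nonempty) (q : ℝ) : 0 ≤ α * q - tau μ q := by
  by_contra! hneg
  obtain ⟨x, hx⟩ := hne
  obtain ⟨η, hη, hκ⟩ : ∃ η > 0, α * q - tau μ q + η * (1 + |q|) < 0 := by
    have hpos : 0 < 1 + |q| := by positivity
    refine ⟨(tau μ q - α * q) / (2 * (1 + |q|)), div_pos (by linarith) (by linarith), ?_⟩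
    field_simp
    linarith
  obtain ⟨N, hN⟩ := mem_iUnion.1 (levelSet_subset_iUnion hη hx)
  obtain ⟨r, hr, hr01⟩ := ((eventually_card_le hfin α q hη Nat.one_div_pos_of_nat).and
    eventually_Ioo_zero_one).exists
  have h1 := hr {x} (by simpa using hN) (by simp)
  have h2 : r ^ (-(α * q - tau μ q + η * (1 + |q|))) < 1 :=
    Real.rpow_lt_one hr01.1.le hr01.2 (by linarith)
  rw [Finset.card_singleton, Nat.cast_one] at h1
  linarith

theorem dimH_powerBoundSet_le [IsFiniteMeasure μ]
    (hfin : ∀ q : ℝ, lqSpectrum μ q ≠ ⊥ ∧ lqSpectrum μ q ≠ ⊤) {α q η ρ : ℝ} (hη : 0 < η)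
    (hρ : 0 < ρ) {t : ℝ≥0∞} (ht : ENNReal.ofReal (α * q - tau μ q + η * (1 + |q|)) < t) :
    dimH (powerBoundSet μ α η ρ) ≤ t := by
  set κ := α * q - tau μ q + η * (1 + |q|) with hκ
  obtain ⟨s, hs, hst⟩ := ENNReal.lt_iff_exists_nnreal_btwn.1 ht
  refine le_trans ?_ hst.le
  have hκs : κ < s := by
    rw [← ENNReal.ofReal_coe_nnreal] at hs
    exact ENNReal.ofReal_lt_ofReal_iff'.1 hs |>.1
  apply dimH_le_of_hausdorffMeasure_ne_top
  have hcov : ∀ᶠ r in 𝓝[>] (0 : ℝ), ∃ F : Finset (EuclideanSpace ℝ (Fin d)),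
      (F.card : ℝ) ≤ r ^ (-κ) ∧
      powerBoundSet μ α η ρ ⊆ ⋃ y : F, closedBall (y : EuclideanSpace ℝ (Fin d)) (2 * r) := by
    filter_upwards [eventually_card_le hfin α q hη hρ, self_mem_nhdsWithin] with r hr (hr0 : 0 < r)
    obtain ⟨F, hFA, hF, hc⟩ := exists_cover_of_card_le (A := powerBoundSet μ α η ρ) (r := r)
      (C := ⌊r ^ (-κ)⌋₊) hr0.le (fun F hFA hF => Nat.le_floor (hr F hFA hF))
    exact ⟨F, hr F hFA hF, hc⟩
  obtain ⟨F, hF⟩ := hcov.choice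
  have hdiam : ∀ (y : EuclideanSpace ℝ (Fin d)) (r : ℝ), 0 < r →
      ediam (closedBall y (2 * r)) ≤ ENNReal.ofReal (4 * r) := fun y r hr => by
    refine ediam_le fun a ha b hb => ?_
    rw [edist_dist]
    apply ENNReal.ofReal_le_ofReal
    have := dist_triangle_right a b y
    linarith [mem_closedBall.1 ha, mem_closedBall.1 hb]
  have hle : μH[(s : ℝ)] (powerBoundSet μ α η ρ) ≤ 0 := by
    have h4 : Tendsto (fun r : ℝ => ENNReal.ofReal (4 * r)) (𝓝[>] 0) (𝓝 0) := by
      have h := ENNReal.continuous_ofReal.comp (continuous_const_mul (4 : ℝ)) |>.tendsto 0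
      simp only [Function.comp_def, mul_zero, ENNReal.ofReal_zero] at h
      exact h.mono_left nhdsWithin_le_nhds
    refine (Measure.hausdorffMeasure_le_liminf_sum (s : ℝ) _ (fun r => ENNReal.ofReal (4 * r)) h4
      (fun r (y : F r) => closedBall (y : EuclideanSpace ℝ (Fin d)) (2 * r)) ?_ ?_).trans ?_
    · filter_upwards [self_mem_nhdsWithin] with r hr y using hdiam y r hr
    · filter_upwards [hF] with r hr using hr.2
    · have hlim : Tendsto (fun r : ℝ => ENNReal.ofReal (4 ^ (s : ℝ) * r ^ ((s : ℝ) - κ))) (𝓝[>] 0)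
          (𝓝 0) := by
        have h1 : Tendsto (fun r : ℝ => r ^ ((s : ℝ) - κ)) (𝓝[>] 0) (𝓝 0) := by
          have := (Real.continuousAt_rpow_const 0 ((s : ℝ) - κ) (Or.inr (by linarith))).tendsto
          rw [Real.zero_rpow (by linarith)] at this
          exact this.mono_left nhdsWithin_le_nhds
        have h2 := h1.const_mul ((4 : ℝ) ^ (s : ℝ))
        rw [mul_zero] at h2
        simpa only [Function.comp_def, ENNReal.ofReal_zero] using
          (ENNReal.continuous_ofReal.tendsto 0).comp h2
      rw [← hlim.liminf_eq]
      refine liminf_le_liminf ?_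
      filter_upwards [hF, self_mem_nhdsWithin] with r hr (hr0 : 0 < r)
      calc ∑ y : F r, ediam (closedBall (y : EuclideanSpace ℝ (Fin d)) (2 * r)) ^ (s : ℝ)
          ≤ ∑ _y : F r, ENNReal.ofReal (4 * r) ^ (s : ℝ) :=
            Finset.sum_le_sum fun y _ => ENNReal.rpow_le_rpow (hdiam y r hr0) s.2
        _ = ENNReal.ofReal ((F r).card * (4 * r) ^ (s : ℝ)) := by
            rw [Finset.sum_const, Finset.card_univ, Fintype.card_coe, nsmul_eq_mul,
              ENNReal.ofReal_rpow_of_pos (by linarith), ENNReal.ofReal_mul (Nat.cast_nonneg _),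
              ENNReal.ofReal_natCast]
        _ ≤ ENNReal.ofReal (4 ^ (s : ℝ) * r ^ ((s : ℝ) - κ)) := by
            apply ENNReal.ofReal_le_ofReal
            calc ((F r).card : ℝ) * (4 * r) ^ (s : ℝ) ≤ r ^ (-κ) * (4 * r) ^ (s : ℝ) := by
                  gcongr
                  exact hr.1
              _ = _ := by
                  rw [Real.mul_rpow (by norm_num) hr0.le, sub_eq_add_neg, Real.rpow_add hr0]
                  ring
  simp [le_antisymm hle (zero_le)]

/-- The upper bound for the dimension of level sets: a packing of points of `E(α)` by balls of radius
`r` contributes `r ^ (α q)` per ball to `Θ(q; r)`. -/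
theorem dimH_levelSet_le [IsFiniteMeasure μ]
    (hfin : ∀ q : ℝ, lqSpectrum μ q ≠ ⊥ ∧ lqSpectrum μ q ≠ ⊤) (α q : ℝ) :
    dimH (levelSet μ α) ≤ ENNReal.ofReal (α * q - tau μ q) := by
  refine le_of_forall_gt_imp_ge_of_dense fun t ht => ?_
  have hlim : Tendsto (fun η : ℝ => ENNReal.ofReal (α * q - tau μ q + η * (1 + |q|))) (𝓝[>] 0)
      (𝓝 (ENNReal.ofReal (α * q - tau μ q))) := by
    have h : Continuous fun η : ℝ => α * q - tau μ q + η * (1 + |q|) := by fun_prop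
    have h' := (ENNReal.continuous_ofReal.comp h).tendsto 0
    simp only [Function.comp_def, zero_mul, add_zero] at h'
    exact h'.mono_left nhdsWithin_le_nhds
  obtain ⟨η, hηt, hη⟩ := ((hlim.eventually_lt_const ht).and self_mem_nhdsWithin).exists
  refine (dimH_mono (levelSet_subset_iUnion (show 0 < η from hη))).trans ?_
  rw [dimH_iUnion]
  exact iSup_le fun N => dimH_powerBoundSet_le hfin hη Nat.one_div_pos_of_nat hηt

end UpperBound

/-! ### Trees of disjoint balls and the mass distribution principle -/

section Moran

variable {d : ℕ}

/-- By comparison of volumes, at most `3 ^ d` disjoint balls of radius `r` meet a set of diameter at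
most `r`. -/
theorem card_le_of_disjoint_of_inter_nonempty {F : Finset (EuclideanSpace ℝ (Fin d))}
    {U : Set (EuclideanSpace ℝ (Fin d))} {r : ℝ} (hr : 0 < r)
    (hF : (F : Set (EuclideanSpace ℝ (Fin d))).PairwiseDisjoint (fun y => closedBall y r))
    (hU : ediam U ≤ ENNReal.ofReal r) (hFU : ∀ y ∈ F, (closedBall y r ∩ U).Nonempty) :
    F.card ≤ 3 ^ d := by
  rcases F.eq_empty_or_nonempty with rfl | ⟨y₀, hy₀⟩
  · simp
  obtain ⟨z, -, hzU⟩ := hFU y₀ hy₀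
  have hsub : (⋃ y ∈ F, closedBall y r) ⊆ closedBall z (3 * r) := by
    refine iUnion₂_subset fun y hy w hw => ?_
    obtain ⟨u, hu, huU⟩ := hFU y hy
    have h1 : dist u z ≤ r := by
      have := (edist_le_ediam_of_mem huU hzU).trans hU
      rwa [edist_dist, ENNReal.ofReal_le_ofReal_iff hr.le] at this
    have h2 := dist_triangle4_right w z y u
    rw [mem_closedBall] at *
    have := dist_triangle w y z
    have := dist_triangle y u z
    rw [dist_comm] at hu
    linarith
  have hvol := measure_mono (μ := (volume : Measure (EuclideanSpace ℝ (Fin d)))) hsub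
  rw [measure_biUnion_finset hF fun y _ => measurableSet_closedBall] at hvol
  simp only [Measure.addHaar_closedBall volume _ hr.le,
    Measure.addHaar_closedBall volume _ (show 0 ≤ 3 * r by linarith), finrank_euclideanSpace,
    Fintype.card_fin, Finset.sum_const, nsmul_eq_mul] at hvol
  rw [← mul_assoc, ENNReal.mul_le_mul_iff_left (measure_ball_pos _ _ one_pos).ne'
    measure_ball_lt_top.ne, ← ENNReal.ofReal_natCast, ← ENNReal.ofReal_mul (Nat.cast_nonneg _),
    ENNReal.ofReal_le_ofReal_iff (by positivity), mul_pow] at hvol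
  have := le_of_mul_le_mul_right hvol (by positivity)
  exact_mod_cast this

/-- The centre of the ball of level `j` reached along the branch `ω` of the tree that starts in `x₀`
and in which the children of `x` at level `j` are the points `c j x i`, `i < N j`. -/
def branch {X : Type*} {N : ℕ → ℕ} (c : ∀ j, X → Fin (N j) → X) (x₀ : X) (ω : ∀ j, Fin (N j)) :
    ℕ → X
  | 0 => x₀
  | j + 1 => c j (branch c x₀ ω j) (ω j)

theorem branch_congr {X : Type*} {N : ℕ → ℕ} {c : ∀ j, X → Fin (N j) → X} {x₀ : X}
    {ω ω' : ∀ j, Fin (N j)} {j : ℕ} (h : ∀ i < j, ω i = ω' i) :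
    branch c x₀ ω j = branch c x₀ ω' j := by
  induction j with
  | zero => rfl
  | succ j ih =>
    simp only [branch]
    rw [ih fun i hi => h i (by omega), h j (by omega)]

theorem measurable_branch {X : Type*} {N : ℕ → ℕ} {c : ∀ j, X → Fin (N j) → X} {x₀ : X}
    [MeasurableSpace X] (hN : ∀ j, 0 < N j) (j : ℕ) :
    Measurable fun ω : ∀ j, Fin (N j) => branch c x₀ ω j := by
  classical
  let ext : (∀ i : Finset.range j, Fin (N i)) → ∀ i, Fin (N i) := fun v i =>
    if h : i ∈ Finset.range j then v ⟨i, h⟩ else ⟨0, hN i⟩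
  have heq : (fun ω : ∀ j, Fin (N j) => branch c x₀ ω j) =
      (fun v => branch c x₀ (ext v) j) ∘ (Finset.range j).restrict := by
    ext ω
    refine branch_congr fun i hi => ?_
    simp [ext, hi]
  rw [heq]
  exact (Measurable.of_discrete).comp (Finset.measurable_restrict _)

/-- The points that lie, at every level `j`, in one of the balls of radius `ρ j` with centre in
`G j`. -/
def limitSet {X : Type*} [PseudoMetricSpace X] (G : ℕ → Set X) (ρ : ℕ → ℝ) : Set X :=
  {x | ∀ j, ∃ y ∈ G j, x ∈ closedBall y (ρ j)}

/-- `c j x` lists the centres of disjoint balls of radius `ρ (j + 1)` inside the ball of radius `ρ j`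
around a point `x` of `G j`; these centres belong to `G (j + 1)`. -/
def IsTree {X : Type*} [PseudoMetricSpace X] {N : ℕ → ℕ} (G : ℕ → Set X) (ρ : ℕ → ℝ)
    (c : ∀ j, X → Fin (N j) → X) : Prop :=
  ∀ j, ∀ x ∈ G j, (∀ i, c j x i ∈ G (j + 1) ∧
    closedBall (c j x i) (ρ (j + 1)) ⊆ closedBall x (ρ j)) ∧
    Pairwise fun i i' => Disjoint (closedBall (c j x i) (ρ (j + 1)))
      (closedBall (c j x i') (ρ (j + 1)))

section Tree

variable {X : Type*} [MetricSpace X] {N : ℕ → ℕ} {G : ℕ → Set X} {ρ : ℕ → ℝ}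
  {c : ∀ j, X → Fin (N j) → X} {x₀ : X}

theorem IsTree.branch_mem (hc : IsTree G ρ c) (hx₀ : x₀ ∈ G 0) (ω : ∀ j, Fin (N j)) (j : ℕ) :
    branch c x₀ ω j ∈ G j := by
  induction j with
  | zero => exact hx₀
  | succ j ih => exact ((hc j _ ih).1 _).1

theorem IsTree.antitone_closedBall (hc : IsTree G ρ c) (hx₀ : x₀ ∈ G 0) (ω : ∀ j, Fin (N j)) :
    Antitone fun j => closedBall (branch c x₀ ω j) (ρ j) :=
  antitone_nat_of_succ_le fun j => ((hc j _ (hc.branch_mem hx₀ ω j)).1 _).2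

theorem IsTree.disjoint_closedBall (hc : IsTree G ρ c) (hx₀ : x₀ ∈ G 0) {ω ω' : ∀ j, Fin (N j)}
    {j : ℕ} (h : ∃ i < j, ω i ≠ ω' i) :
    Disjoint (closedBall (branch c x₀ ω j) (ρ j)) (closedBall (branch c x₀ ω' j) (ρ j)) := by
  induction j with
  | zero => simp at h
  | succ j ih =>
    by_cases h' : ∃ i < j, ω i ≠ ω' i
    · exact (ih h').mono (hc.antitone_closedBall hx₀ ω j.le_succ)
        (hc.antitone_closedBall hx₀ ω' j.le_succ)
    · push Not at h'
      obtain ⟨i, hi, hne⟩ := h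
      obtain rfl : i = j := by
        by_contra hij
        exact hne (h' i (by omega))
      simp only [branch]
      rw [branch_congr h']
      exact (hc i _ (hc.branch_mem hx₀ ω' i)).2 hne

theorem IsTree.exists_limit [CompleteSpace X] (hc : IsTree G ρ c) (hx₀ : x₀ ∈ G 0)
    (hρ : ∀ j, 0 < ρ j) (hlim : Tendsto ρ atTop (𝓝 0)) (ω : ∀ j, Fin (N j)) :
    ∃ x, (∀ j, x ∈ closedBall (branch c x₀ ω j) (ρ j)) ∧
      Tendsto (branch c x₀ ω) atTop (𝓝 x) := by
  have hmem : ∀ j k, j ≤ k → branch c x₀ ω k ∈ closedBall (branch c x₀ ω j) (ρ j) :=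
    fun j k hjk => hc.antitone_closedBall hx₀ ω hjk (mem_closedBall_self (hρ k).le)
  have hcau : CauchySeq (branch c x₀ ω) := by
    refine cauchySeq_of_le_tendsto_0' ρ (fun j k hjk => ?_) hlim
    rw [dist_comm]
    exact hmem j k hjk
  obtain ⟨x, hx⟩ := cauchySeq_tendsto_of_complete hcau
  exact ⟨x, fun j => isClosed_closedBall.mem_of_tendsto hx
    (eventually_atTop.2 ⟨j, fun k hk => hmem j k hk⟩), hx⟩

end Tree

/-- The mass distribution on the tree: the Bernoulli measure on the branches for which the children of
every vertex are equally likely. -/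
noncomputable def uniformBranchMeasure {N : ℕ → ℕ} (hN : ∀ j, 0 < N j) : Measure (∀ j, Fin (N j)) :=
  Measure.infinitePi fun j =>
    haveI : Nonempty (Fin (N j)) := Fin.pos_iff_nonempty.1 (hN j)
    (PMF.uniformOfFintype (Fin (N j))).toMeasure

instance {N : ℕ → ℕ} (hN : ∀ j, 0 < N j) : IsProbabilityMeasure (uniformBranchMeasure hN) := by
  unfold uniformBranchMeasure
  infer_instance

theorem uniformBranchMeasure_restrict {N : ℕ → ℕ} (hN : ∀ j, 0 < N j) (j : ℕ)
    (v : ∀ i : Finset.range j, Fin (N i)) :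
    uniformBranchMeasure hN ((Finset.range j).restrict ⁻¹' {v}) =
      ((∏ i ∈ Finset.range j, N i : ℕ) : ℝ≥0∞)⁻¹ := by
  have : ∀ j, Nonempty (Fin (N j)) := fun j => Fin.pos_iff_nonempty.1 (hN j)
  have h := Measure.infinitePi_cylinder
    (fun j => (PMF.uniformOfFintype (Fin (N j))).toMeasure) (s := Finset.range j) (S := {v})
    (measurableSet_singleton v)
  rw [Measure.pi_singleton] at h
  refine h.trans ?_
  simp only [PMF.toMeasure_apply_singleton _ _ (measurableSet_singleton _),
    PMF.uniformOfFintype_apply, Fintype.card_fin]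
  rw [Finset.prod_coe_sort (Finset.range j) (fun i => ((N i : ℕ) : ℝ≥0∞)⁻¹), Nat.cast_prod]
  exact (ENNReal.prod_inv_distrib fun _ _ _ _ _ => Or.inr (ENNReal.natCast_ne_top _)).symm

theorem measure_preimage_le {N : ℕ → ℕ} (hN : ∀ j, 0 < N j)
    {G : ℕ → Set (EuclideanSpace ℝ (Fin d))} {ρ : ℕ → ℝ}
    {c : ∀ j, EuclideanSpace ℝ (Fin d) → Fin (N j) → EuclideanSpace ℝ (Fin d)}
    {x₀ : EuclideanSpace ℝ (Fin d)} (hc : IsTree G ρ c) (hx₀ : x₀ ∈ G 0) (hρ : ∀ j, 0 < ρ j)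
    {p : (∀ j, Fin (N j)) → EuclideanSpace ℝ (Fin d)}
    (hp : ∀ ω j, p ω ∈ closedBall (branch c x₀ ω j) (ρ j)) {j : ℕ}
    {U : Set (EuclideanSpace ℝ (Fin d))} (hU : ediam U ≤ ENNReal.ofReal (ρ j)) :
    uniformBranchMeasure hN (p ⁻¹' U) ≤
      3 ^ d * ((∏ i ∈ Finset.range j, N i : ℕ) : ℝ≥0∞)⁻¹ := by
  classical
  have : Nonempty (∀ j, Fin (N j)) := ⟨fun j => ⟨0, hN j⟩⟩
  let W : Finset (∀ i : Finset.range j, Fin (N i)) :=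
    ((Finset.range j).restrict '' (p ⁻¹' U)).toFinset
  have hW : ∀ v ∈ W, ∃ ω, p ω ∈ U ∧ (Finset.range j).restrict ω = v := fun v hv => by
    simpa [W] using hv
  choose! e heU hev using hW
  have hdis : ∀ v ∈ W, ∀ v' ∈ W, v ≠ v' → Disjoint (closedBall (branch c x₀ (e v) j) (ρ j))
      (closedBall (branch c x₀ (e v') j) (ρ j)) := fun v hv v' hv' hne => by
    apply hc.disjoint_closedBall hx₀
    by_contra! h
    refine hne ?_
    rw [← hev v hv, ← hev v' hv']
    ext i
    exact congrArg Fin.val (h i (Finset.mem_range.1 i.2))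
  have hinj : Set.InjOn (fun v => branch c x₀ (e v) j) W := fun v hv v' hv' heq => by
    by_contra hne
    have h := hdis v hv v' hv' hne
    have heq : branch c x₀ (e v) j = branch c x₀ (e v') j := heq
    rw [heq, disjoint_self, Set.bot_eq_empty, closedBall_eq_empty] at h
    exact absurd h (hρ j).le.not_gt
  have hcard : W.card ≤ 3 ^ d := by
    rw [← Finset.card_image_of_injOn hinj]
    refine card_le_of_disjoint_of_inter_nonempty (hρ j) ?_ hU ?_
    · intro y hy y' hy' hne
      simp only [Finset.coe_image, Set.mem_image] at hy hy'
      obtain ⟨v, hv, rfl⟩ := hy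
      obtain ⟨v', hv', rfl⟩ := hy'
      exact hdis v hv v' hv' fun h => hne (by rw [h])
    · intro y hy
      obtain ⟨v, hv, rfl⟩ := Finset.mem_image.1 hy
      exact ⟨p (e v), hp _ j, heU v hv⟩
  have hsub : p ⁻¹' U ⊆ ⋃ v ∈ W, (Finset.range j).restrict ⁻¹' {v} := fun ω hω =>
    mem_iUnion₂.2 ⟨(Finset.range j).restrict ω, by simpa [W] using ⟨ω, hω, rfl⟩, rfl⟩
  calc uniformBranchMeasure hN (p ⁻¹' U)
      ≤ ∑ v ∈ W, uniformBranchMeasure hN ((Finset.range j).restrict ⁻¹' {v}) :=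
        (measure_mono hsub).trans (measure_biUnion_finset_le _ _)
    _ = W.card * ((∏ i ∈ Finset.range j, N i : ℕ) : ℝ≥0∞)⁻¹ := by
        simp [uniformBranchMeasure_restrict]
    _ ≤ _ := by
        gcongr
        exact_mod_cast hcard

/-- A tree of disjoint balls in which the vertices of level `j` have `N j` children has limit points,
and the mass distribution principle bounds the dimension of the limit set from below. -/
theorem IsTree.le_dimH_limitSet {N : ℕ → ℕ} (hN : ∀ j, 0 < N j)
    {G : ℕ → Set (EuclideanSpace ℝ (Fin d))} {ρ : ℕ → ℝ}
    {c : ∀ j, EuclideanSpace ℝ (Fin d) → Fin (N j) → EuclideanSpace ℝ (Fin d)}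
    {x₀ : EuclideanSpace ℝ (Fin d)} (hc : IsTree G ρ c) (hx₀ : x₀ ∈ G 0) (hρ : ∀ j, 0 < ρ j)
    (hlim : Tendsto ρ atTop (𝓝 0)) (hanti : Antitone ρ) {s : ℝ}
    (hs : ∀ t < s, ∀ᶠ j in atTop, ρ (j + 1) ^ (-t) ≤ (∏ i ∈ Finset.range j, N i : ℕ)) :
    (limitSet G ρ).Nonempty ∧ ENNReal.ofReal s ≤ dimH (limitSet G ρ) := by
  choose p hp hpl using hc.exists_limit hx₀ hρ hlim
  have hpm : Measurable p := measurable_of_tendsto_metrizable (measurable_branch hN)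
    (tendsto_pi_nhds.2 hpl)
  have hpK : ∀ ω, p ω ∈ limitSet G ρ := fun ω j => ⟨_, hc.branch_mem hx₀ ω j, hp ω j⟩
  refine ⟨⟨p fun j => ⟨0, hN j⟩, hpK _⟩, ?_⟩
  refine le_of_forall_lt fun a ha => ?_
  obtain ⟨t, hat, hts⟩ := ENNReal.lt_iff_exists_nnreal_btwn.1 ha
  refine hat.trans_le ?_
  clear a ha hat
  have hts : (t : ℝ) < s := by
    rw [← ENNReal.ofReal_coe_nnreal] at hts
    exact (ENNReal.ofReal_lt_ofReal_iff'.1 hts).1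
  rcases eq_zero_or_pos t with rfl | ht
  · simp
  have ht' : (0 : ℝ) < t := ht
  obtain ⟨J, hJ⟩ := eventually_atTop.1 (hs t hts)
  set ν : Measure (EuclideanSpace ℝ (Fin d)) := (uniformBranchMeasure hN).map p with hν
  -- a set of diameter at most `ρ j` has measure at most `3 ^ d * ρ (j + 1) ^ t`
  have hνU : ∀ j ≥ J, ∀ U : Set (EuclideanSpace ℝ (Fin d)), ediam U ≤ ENNReal.ofReal (ρ j) →
      ν U ≤ 3 ^ d * ENNReal.ofReal (ρ (j + 1)) ^ (t : ℝ) := by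
    intro j hj U hU
    refine (measure_mono subset_closure).trans ?_
    rw [hν, Measure.map_apply hpm isClosed_closure.measurableSet]
    refine (measure_preimage_le hN hc hx₀ hρ hp (j := j) (by rwa [ediam_closure])).trans ?_
    gcongr
    rw [ENNReal.inv_le_iff_inv_le, ENNReal.ofReal_rpow_of_pos (hρ _), ← ENNReal.ofReal_inv_of_pos
      (Real.rpow_pos_of_pos (hρ _) _), ← Real.rpow_neg (hρ _).le, ← ENNReal.ofReal_natCast]
    exact ENNReal.ofReal_le_ofReal (hJ j hj)
  have hmass : ((3 : ℝ≥0∞) ^ d)⁻¹ • ν ≤ μH[(t : ℝ)] := by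
    refine Measure.le_hausdorffMeasure _ _ (ENNReal.ofReal (ρ J)) (ENNReal.ofReal_pos.2 (hρ J))
      fun U hU => ?_
    rw [Measure.smul_apply, smul_eq_mul, ENNReal.inv_mul_le_iff (by positivity) (by finiteness)]
    rcases eq_or_ne (ediam U) 0 with h0 | h0
    · rw [h0, ENNReal.zero_rpow_of_pos ht', mul_zero]
      have hl : Tendsto (fun j => (3 : ℝ≥0∞) ^ d * ENNReal.ofReal (ρ (j + 1)) ^ (t : ℝ)) atTop
          (𝓝 0) := by
        have h1 := (ENNReal.continuous_ofReal.tendsto 0).comp (hlim.comp (tendsto_add_atTop_nat 1))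
        have h2 := (ENNReal.continuous_rpow_const (y := (t : ℝ)) |>.tendsto _).comp h1
        have h3 := ENNReal.Tendsto.const_mul (a := (3 : ℝ≥0∞) ^ d) h2 (Or.inr (by finiteness))
        simpa [Function.comp_def, ENNReal.zero_rpow_of_pos ht'] using h3
      refine ge_of_tendsto hl (eventually_atTop.2 ⟨J, fun j hj => hνU j hj U ?_⟩)
      simp [h0]
    · -- the last level whose radius is at least the diameter of `U`
      have hex : ∃ j, ENNReal.ofReal (ρ j) < ediam U := by
        have h1 := (ENNReal.continuous_ofReal.tendsto 0).comp hlim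
        rw [ENNReal.ofReal_zero] at h1
        exact (h1.eventually_lt_const (pos_iff_ne_zero.2 h0)).exists
      classical
      have hspec := Nat.find_spec hex
      have hJlt : J < Nat.find hex := by
        by_contra! h
        exact absurd (hU.trans (ENNReal.ofReal_le_ofReal (hanti h))) hspec.not_ge
      obtain ⟨k, hk⟩ : ∃ k, Nat.find hex = k + 1 := ⟨Nat.find hex - 1, by omega⟩
      have hle : ediam U ≤ ENNReal.ofReal (ρ k) := not_lt.1 (Nat.find_min hex (by omega))
      refine (hνU k (by omega) U hle).trans ?_
      rw [hk] at hspec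
      gcongr
  refine le_dimH_of_hausdorffMeasure_ne_zero (pos_iff_ne_zero.1 ?_)
  refine lt_of_lt_of_le ?_ (hmass (limitSet G ρ))
  rw [Measure.smul_apply, smul_eq_mul]
  refine ENNReal.mul_pos (ENNReal.inv_ne_zero.2 (by finiteness)) (pos_iff_ne_zero.1 ?_)
  refine lt_of_lt_of_le one_pos ?_
  calc (1 : ℝ≥0∞) = uniformBranchMeasure hN (p ⁻¹' limitSet G ρ) := by
        rw [show p ⁻¹' limitSet G ρ = univ from eq_univ_of_forall hpK, measure_univ]
    _ ≤ ν (limitSet G ρ) := Measure.le_map_apply hpm.aemeasurable _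

end Moran

/-! ### Schedules for iterating the local box-counting principle -/

section Schedule

variable {d : ℕ} {μ : Measure (EuclideanSpace ℝ (Fin d))}

/-- The dyadic radius `2⁻ⁿ`. -/
noncomputable def rad (n : ℕ) : ℝ := 2 ^ (-(n : ℤ))

theorem rad_pos (n : ℕ) : 0 < rad n := by unfold rad; positivity

theorem rad_eq_rpow (n : ℕ) : rad n = (2 : ℝ) ^ (-(n : ℝ)) := by
  rw [rad, ← Real.rpow_intCast]
  push_cast
  rfl

theorem rad_succ (n : ℕ) : 2 * rad (n + 1) = rad n := by
  rw [rad, rad, ← zpow_one_add₀ two_ne_zero]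
  congr 1
  push_cast
  ring

theorem rad_antitone : Antitone rad :=
  antitone_nat_of_succ_le fun n => by linarith [rad_succ n, rad_pos (n + 1)]

theorem tendsto_rad : Tendsto rad atTop (𝓝 0) := by
  have h : rad = fun n : ℕ => (1 / 2 : ℝ) ^ n := by
    ext n
    rw [rad, zpow_neg, zpow_natCast, one_div, inv_pow]
  rw [h]
  exact tendsto_pow_atTop_nhds_zero_of_lt_one (by norm_num) (by norm_num)

/-- The centres at which passing from the radius `2⁻ⁿ⁻¹` to `2⁻ⁿ⁺¹` multiplies the measure by at most
`R`. -/
def doublingCentres (μ : Measure (EuclideanSpace ℝ (Fin d))) (R : ℝ) (n : ℕ) :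
    Set (EuclideanSpace ℝ (Fin d)) :=
  {x | 0 < μ.real (closedBall x (rad (n + 1))) ∧
    μ.real (closedBall x (2 * rad n)) ≤ R * μ.real (closedBall x (rad (n + 1)))}

theorem doublingCentres_mono {R R' : ℝ} (h : R ≤ R') (n : ℕ) :
    doublingCentres μ R n ⊆ doublingCentres μ R' n := fun _ hx =>
  ⟨hx.1, hx.2.trans (mul_le_mul_of_nonneg_right h hx.1.le)⟩

/-- `m` levels below the ball of radius `2⁻ⁿ` around `x` there are at least `2 ^ (m (σ - ε))` disjoint
balls inside it whose relative measures are between `2 ^ (-m (β + ε))` and `2 ^ (-m (β - ε))` and whose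
centres satisfy the doubling condition with constant `R`. -/
def HasBoxes (μ : Measure (EuclideanSpace ℝ (Fin d))) (β σ ε R : ℝ) (n m : ℕ)
    (x : EuclideanSpace ℝ (Fin d)) : Prop :=
  ∃ F : Finset (EuclideanSpace ℝ (Fin d)),
    (F : Set (EuclideanSpace ℝ (Fin d))).PairwiseDisjoint (fun y => closedBall y (rad (n + m))) ∧
    (2 : ℝ) ^ ((m : ℝ) * (σ - ε)) ≤ F.card ∧
    ∀ y ∈ F, closedBall y (rad (n + m)) ⊆ closedBall x (rad n) ∧
      (2 : ℝ) ^ (-(m : ℝ) * (β + ε)) * μ.real (closedBall x (rad n)) ≤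
        μ.real (closedBall y (rad (n + m))) ∧
      μ.real (closedBall y (rad (n + m))) ≤
        (2 : ℝ) ^ (-(m : ℝ) * (β - ε)) * μ.real (closedBall x (rad n)) ∧
      y ∈ doublingCentres μ R (n + m)

theorem HasBoxes.mono_constant {β σ ε R R' : ℝ} {n m : ℕ} {x : EuclideanSpace ℝ (Fin d)}
    (h : HasBoxes μ β σ ε R n m x) (hR : R ≤ R') : HasBoxes μ β σ ε R' n m x := by
  obtain ⟨F, h1, h2, h3⟩ := h
  exact ⟨F, h1, h2, fun y hy => ⟨(h3 y hy).1, (h3 y hy).2.1, (h3 y hy).2.2.1,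
    doublingCentres_mono hR _ (h3 y hy).2.2.2⟩⟩

/-- The local box-counting principle with `k` so large that `1 / k` and `b k` are at most `ε`. -/
theorem exists_hasBoxes [IsFiniteMeasure μ] {q ε : ℝ} (h : LocalBoxCounting μ q) (hε : 0 < ε) :
    ∃ (a : ℝ) (f : ℕ → ℝ), 0 < a ∧ (∀ n, 0 < f n) ∧ Tendsto (fun n : ℕ => f n / n) atTop (𝓝 0) ∧
      ∀ (n : ℕ) (x : EuclideanSpace ℝ (Fin d)), 0 < μ.real (closedBall x (rad (n + 1))) →
        ∀ m : ℕ, f n + a * Real.log (μ.real (closedBall x (rad n)) /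
            μ.real (closedBall x (rad (n + 1)))) ≤ m →
          HasBoxes μ (deriv (tau μ) q) (deriv (tau μ) q * q - tau μ q) ε (f (n + m)) n m x := by
  obtain ⟨a, b, f, hpos, hb, hf, H⟩ := h
  obtain ⟨k, hk1, hkb, hkε⟩ := ((eventually_ge_atTop 1).and ((hb.eventually_lt_const hε).and
    (tendsto_one_div_atTop_nhds_zero_nat.eventually_lt_const hε))).exists
  refine ⟨a k, f k, (hpos k hk1).1, (hpos k hk1).2.2, hf k hk1, fun n x hx m hm => ?_⟩
  have e1 : (2 : ℝ) ^ (-(n : ℤ) - 1) = rad (n + 1) := by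
    rw [rad]; congr 1; push_cast; ring
  have e2 : (2 : ℝ) ^ (-(n : ℤ) - m) = rad (n + m) := by
    rw [rad]; congr 1; push_cast; ring
  have e3 : (2 : ℝ) ^ (-(n : ℤ) - m - 1) = rad (n + m + 1) := by
    rw [rad]; congr 1; push_cast; ring
  have e4 : (2 : ℝ) ^ (-(n : ℤ) - m + 1) = 2 * rad (n + m) := by
    rw [rad, ← zpow_one_add₀ two_ne_zero]; congr 1; push_cast; ring
  have e5 : (2 : ℝ) ^ (-(n : ℤ)) = rad n := rfl
  obtain ⟨F, hF, hcard, hprop⟩ := H k hk1 n x (by rwa [e1]) m (by rwa [e1])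
  simp only [e2, e3, e4, e5] at hF hprop
  have hxn : 0 < μ.real (closedBall x (rad n)) :=
    hx.trans_le (measureReal_mono (closedBall_subset_closedBall (rad_antitone n.le_succ)))
  refine ⟨F, hF, le_trans ?_ hcard, fun y hy => ?_⟩
  · apply Real.rpow_le_rpow_of_exponent_le one_le_two
    gcongr
  · obtain ⟨h1, h2, h3, h4, h5⟩ := hprop y hy
    rw [le_div_iff₀ hxn] at h2
    rw [div_le_iff₀ hxn] at h3
    rw [div_le_iff₀ h4] at h5
    refine ⟨h1, le_trans ?_ h2, h3.trans ?_, h4, h5⟩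
    · refine mul_le_mul_of_nonneg_right ?_ hxn.le
      apply Real.rpow_le_rpow_of_exponent_le one_le_two
      rw [neg_mul, neg_mul, neg_le_neg_iff]
      gcongr
    · refine mul_le_mul_of_nonneg_right ?_ hxn.le
      apply Real.rpow_le_rpow_of_exponent_le one_le_two
      rw [neg_mul, neg_mul, neg_le_neg_iff]
      gcongr

theorem exists_monotone_diagonal {Q : ℕ → ℕ → Prop} (hQ : ∀ p, ∀ᶠ n in atTop, Q p n) :
    ∃ P : ℕ → ℕ, Monotone P ∧ Tendsto P atTop atTop ∧ ∀ᶠ n in atTop, Q (P n) n := by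
  classical
  choose T hT using fun p => eventually_atTop.1 (hQ p)
  refine ⟨fun n => Nat.findGreatest (fun p => ∀ p' ≤ p, T p' ≤ n) n, ?_, ?_, ?_⟩
  · intro n n' hn
    exact Nat.findGreatest_mono (fun p hp p' hp' => (hp p' hp').trans hn) hn
  · refine tendsto_atTop.2 fun p => ?_
    filter_upwards [eventually_ge_atTop p, (Finset.range (p + 1)).eventually_all.2
      fun p' _ => eventually_ge_atTop (T p')] with n hn hn'
    exact Nat.le_findGreatest hn fun p' hp' => hn' p' (Finset.mem_range.2 (by omega))
  · filter_upwards [eventually_ge_atTop (T 0)] with n hn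
    have := Nat.findGreatest_spec (P := fun p => ∀ p' ≤ p, T p' ≤ n) (Nat.zero_le n)
      (fun p' hp' => by rwa [Nat.le_zero.1 hp'])
    exact hT _ n (this _ le_rfl)

/-- Parameters, depending on the level `n` only, for the construction of a tree of balls: from every
centre that is doubling at level `n` with constant `R n` one can pass to level `n + M n`, with either
of two exponents `β i n`, and find centres with the constant `R (n + M n)`. All errors are `o(n)`. -/
structure IsSchedule (μ : Measure (EuclideanSpace ℝ (Fin d))) (α s lam : ℝ) (R ε : ℕ → ℝ) (M : ℕ → ℕ)
    (β σ : Bool → ℕ → ℝ) : Prop where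
  eps_pos : ∀ n, 0 < ε n
  eps_tendsto : Tendsto ε atTop (𝓝 0)
  one_le : ∀ n, 1 ≤ M n
  le_beta : ∀ n, α - ε n ≤ β true n
  beta_le : ∀ n, β false n ≤ α + ε n
  le_sigma : ∀ i n, s + lam * (β i n - α) - ε n ≤ σ i n
  constant_le : ∀ᶠ n in atTop, R n ≤ 2 ^ (ε n * n)
  mul_le : ∀ᶠ n in atTop, ∀ i, M n * (1 + |β i n - α|) ≤ ε n * n
  nonempty : ∀ᶠ n in atTop, (doublingCentres μ (R n) n).Nonempty
  hasBoxes : ∀ i n, ∀ x ∈ doublingCentres μ (R n) n,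
    HasBoxes μ (β i n) (σ i n) (ε n) (R (n + M n)) n (M n) x

theorem exists_isSchedule [IsFiniteMeasure μ] (hμ : μ.support.Nonempty) {α s lam : ℝ}
    (h : ∀ ε > 0, ∃ q : Bool → ℝ, (∀ i, LocalBoxCounting μ (q i)) ∧
      α - ε ≤ deriv (tau μ) (q true) ∧ deriv (tau μ) (q false) ≤ α + ε ∧
      ∀ i, s + lam * (deriv (tau μ) (q i) - α) - ε ≤
        deriv (tau μ) (q i) * q i - tau μ (q i)) :
    ∃ R ε M β σ, IsSchedule μ α s lam R ε M β σ := by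
  have hεp : ∀ p : ℕ, (0 : ℝ) < 1 / (p + 1) := fun p => Nat.one_div_pos_of_nat
  choose q hq hqt hqf hqs using fun p : ℕ => h (1 / (p + 1)) (hεp p)
  choose a f ha hf hfn hbox using fun p i => exists_hasBoxes (hq p i) (hεp p)
  -- `S p n` dominates the doubling constants of all the stages up to `p`
  let S : ℕ → ℕ → ℝ := fun p n => 1 + ∑ p' ∈ Finset.range (p + 1), ∑ i, f p' i n
  have hfS : ∀ {p p'} i n, p ≤ p' → f p i n ≤ S p' n := fun {p p'} i n hp => by
    have h1 : f p i n ≤ ∑ i, f p i n :=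
      Finset.single_le_sum (f := fun i => f p i n) (fun i _ => (hf p i n).le) (Finset.mem_univ i)
    have h2 : ∑ i, f p i n ≤ ∑ p' ∈ Finset.range (p' + 1), ∑ i, f p' i n :=
      Finset.single_le_sum (f := fun p => ∑ i, f p i n)
        (fun p _ => Finset.sum_nonneg fun i _ => (hf p i n).le) (Finset.mem_range.2 (by omega))
    simp only [S]
    linarith
  have hS1 : ∀ p n, 1 ≤ S p n := fun p n => by
    have : 0 ≤ ∑ p' ∈ Finset.range (p + 1), ∑ i, f p' i n :=
      Finset.sum_nonneg fun p _ => Finset.sum_nonneg fun i _ => (hf p i n).le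
    simp only [S]
    linarith
  have hinv : ∀ c : ℝ, Tendsto (fun n : ℕ => c / (n : ℝ)) atTop (𝓝 0) := fun c =>
    tendsto_const_nhds.div_atTop tendsto_natCast_atTop_atTop
  have hSn : ∀ p, Tendsto (fun n : ℕ => S p n / n) atTop (𝓝 0) := fun p => by
    have h1 := (hinv 1).add (tendsto_finsetSum (Finset.range (p + 1)) fun p' _ =>
      tendsto_finsetSum Finset.univ fun i _ => hfn p' i)
    simp only [Finset.sum_const_zero, add_zero] at h1
    refine h1.congr fun n => ?_
    simp only [S, add_div, Finset.sum_div]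
  let g : ℕ → ℕ → ℝ := fun p n => ∑ i, (f p i n + a p i * Real.log (S p n))
  let m : ℕ → ℕ → ℕ := fun p n => ⌈g p n⌉₊ + 1
  have hgnn : ∀ p i n, 0 ≤ f p i n + a p i * Real.log (S p n) := fun p i n =>
    add_nonneg (hf p i n).le (mul_nonneg (ha p i).le (Real.log_nonneg (hS1 p n)))
  have hg0 : ∀ p n, 0 ≤ g p n := fun p n => Finset.sum_nonneg fun i _ => hgnn p i n
  have hgi : ∀ p i n, f p i n + a p i * Real.log (S p n) ≤ g p n := fun p i n =>
    Finset.single_le_sum (f := fun i => f p i n + a p i * Real.log (S p n))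
      (fun i _ => hgnn p i n) (Finset.mem_univ i)
  have hmn : ∀ p, Tendsto (fun n : ℕ => (m p n : ℝ) / n) atTop (𝓝 0) := fun p => by
    have h1 : Tendsto (fun n : ℕ => ∑ i, (f p i n / n + a p i * (S p n / n)) + 2 / (n : ℝ)) atTop
        (𝓝 0) := by
      have h2 := (tendsto_finsetSum Finset.univ fun i _ =>
        (hfn p i).add ((hSn p).const_mul (a p i))).add (hinv 2)
      simpa using h2
    refine squeeze_zero (fun n => by positivity) (fun n => ?_) h1
    have h3 : (m p n : ℝ) ≤ ∑ i, (f p i n + a p i * S p n) + 2 := by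
      have h4 := Nat.ceil_lt_add_one (hg0 p n)
      have h5 : g p n ≤ ∑ i, (f p i n + a p i * S p n) := by
        refine Finset.sum_le_sum fun i _ => ?_
        have := mul_le_mul_of_nonneg_left
          ((Real.log_le_sub_one_of_pos (by linarith [hS1 p n])).trans (sub_one_lt (S p n)).le)
          (ha p i).le
        linarith
      simp only [m]
      push_cast
      linarith
    refine (div_le_div_of_nonneg_right h3 (Nat.cast_nonneg n)).trans_eq ?_
    rw [add_div, Finset.sum_div]
    congr 1
    refine Finset.sum_congr rfl fun i _ => ?_
    rw [add_div, mul_div_assoc]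
  have hev : ∀ p, ∀ᶠ n : ℕ in atTop, S p n ≤ 1 / ((p : ℝ) + 1) * n ∧
      ∀ i, m p n * (1 + |deriv (tau μ) (q p i) - α|) ≤ 1 / ((p : ℝ) + 1) * n := fun p => by
    have h2 : ∀ i, Tendsto (fun n : ℕ => (m p n : ℝ) / n * (1 + |deriv (tau μ) (q p i) - α|)) atTop
        (𝓝 0) := fun i => by simpa using (hmn p).mul_const (1 + |deriv (tau μ) (q p i) - α|)
    filter_upwards [(hSn p).eventually_lt_const (hεp p),
      eventually_all.2 fun i => (h2 i).eventually_lt_const (hεp p), eventually_gt_atTop 0]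
      with n h3 h4 hn
    have hn' : (0 : ℝ) < n := by exact_mod_cast hn
    refine ⟨((div_lt_iff₀ hn').1 h3).le, fun i => ?_⟩
    have := h4 i
    rw [div_mul_eq_mul_div] at this
    exact ((div_lt_iff₀ hn').1 this).le
  obtain ⟨P, hPm, hPt, hP⟩ := exists_monotone_diagonal hev
  refine ⟨fun n => S (P n) n, fun n => 1 / (P n + 1), fun n => m (P n) n,
    fun i n => deriv (tau μ) (q (P n) i),
    fun i n => deriv (tau μ) (q (P n) i) * q (P n) i - tau μ (q (P n) i), ?_⟩
  refine ⟨fun n => hεp _, tendsto_one_div_add_atTop_nhds_zero_nat.comp hPt,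
    fun n => by simp [m], fun n => hqt _, fun n => hqf _, fun i n => hqs _ i, ?_, ?_, ?_, ?_⟩
  · filter_upwards [hP] with n hn
    have h2 := one_add_mul_self_le_rpow_one_add (s := 1) (by norm_num) ((hS1 _ n).trans hn.1)
    rw [one_add_one_eq_two] at h2
    linarith [hn.1]
  · filter_upwards [hP] with n hn using hn.2
  · obtain ⟨x, hx⟩ := hμ
    obtain ⟨k, hk⟩ := exists_nat_ge (f 0 true 0 + a 0 true * Real.log (μ.real (closedBall x (rad 0)) /
      μ.real (closedBall x (rad (0 + 1)))))
    filter_upwards [eventually_ge_atTop k] with n hn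
    obtain ⟨F, -, hF, hF'⟩ := hbox 0 true 0 x (measureReal_closedBall_pos hx (rad_pos _)) n
      (hk.trans (by exact_mod_cast hn))
    have hcard : 0 < F.card := by
      have := (Real.rpow_pos_of_pos two_pos _).trans_le hF
      exact_mod_cast this
    obtain ⟨y, hy⟩ := Finset.card_pos.1 hcard
    have := (hF' y hy).2.2.2
    rw [zero_add] at this
    exact ⟨y, doublingCentres_mono (hfS true n (Nat.zero_le _)) n this⟩
  · intro i n x hx
    refine (hbox (P n) i n x hx.1 (m (P n) n) ?_).mono_constant
      (hfS i _ (hPm (Nat.le_add_right _ _)))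
    have h1 : Real.log (μ.real (closedBall x (rad n)) / μ.real (closedBall x (rad (n + 1)))) ≤
        Real.log (S (P n) n) := by
      have h2 : μ.real (closedBall x (rad (n + 1))) ≤ μ.real (closedBall x (rad n)) :=
        measureReal_mono (closedBall_subset_closedBall (rad_antitone n.le_succ))
      have h3 : μ.real (closedBall x (rad n)) ≤ μ.real (closedBall x (2 * rad n)) :=
        measureReal_mono (closedBall_subset_closedBall (by linarith [rad_pos n]))
      refine Real.log_le_log (div_pos (hx.1.trans_le h2) hx.1) ?_
      rw [div_le_iff₀ hx.1]
      exact h3.trans hx.2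
    have h2 := mul_le_mul_of_nonneg_left h1 (ha (P n) i).le
    have h3 := hgi (P n) i n
    have h4 := Nat.le_ceil (g (P n) n)
    simp only [m]
    push_cast
    linarith

end Schedule

/-! ### Steering the local dimension -/

section Levels

theorem eventually_le_mul_of_le_max {n : ℕ → ℕ} (hn : StrictMono n) {η : ℕ → ℝ}
    (hη : Tendsto η atTop (𝓝 0)) {D : ℕ → ℝ}
    (hD : ∀ j, D (j + 1) ≤ max (D j + η j * (n (j + 1) - n j)) (η j * n j)) {δ : ℝ} (hδ : 0 < δ) :
    ∀ᶠ j in atTop, D j ≤ δ * n j := by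
  obtain ⟨J, hJ⟩ := eventually_atTop.1 (hη.eventually_lt_const (half_pos hδ))
  have key : ∀ j, J ≤ j → D j ≤ |D J| + δ / 2 * n j := fun j hj => by
    induction j, hj using Nat.le_induction with
    | base =>
      have : 0 ≤ δ / 2 * (n J : ℝ) := by positivity
      linarith [le_abs_self (D J)]
    | succ j hj ih =>
      have hnn : (n j : ℝ) ≤ n (j + 1) := by exact_mod_cast (hn j.lt_succ_self).le
      have h1 := (hJ j hj).le
      have h2 := mul_le_mul_of_nonneg_right h1 (sub_nonneg.2 hnn)
      have h3 := mul_le_mul_of_nonneg_right h1 (Nat.cast_nonneg (α := ℝ) (n j))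
      have h4 := mul_le_mul_of_nonneg_left hnn (half_pos hδ).le
      refine (hD j).trans (max_le ?_ ?_)
      · linarith
      · linarith [abs_nonneg (D J)]
  have hlim : Tendsto (fun j => δ / 2 * (n j : ℝ)) atTop atTop :=
    (tendsto_natCast_atTop_atTop.comp hn.tendsto_atTop).const_mul_atTop (half_pos hδ)
  filter_upwards [hlim.eventually_ge_atTop |D J|, eventually_ge_atTop J] with j h1 h2
  linarith [key j h2]

/-- Two-sided control of a monotone function along a sequence of dyadic radii `2 ^ (-n j)` with
`n (j + 1) / n j → 1` determines its logarithmic order at all radii. -/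
theorem tendsto_log_div_log {h : ℝ → ℝ} (hmono : Monotone h) {n : ℕ → ℕ} (hn : StrictMono n)
    {u : ℕ → ℝ} {α : ℝ} (hup : ∀ j, h (rad (n j)) ≤ 2 ^ (-(α * n j - u j)))
    (hlo : ∀ j, (2 : ℝ) ^ (-(α * n j + u j)) ≤ h (2 * rad (n j)))
    (hu : ∀ δ > 0, ∀ᶠ j in atTop, u j ≤ δ * n j)
    (hm : ∀ δ > 0, ∀ᶠ j in atTop, (n (j + 1) : ℝ) - n j ≤ δ * n j) :
    Tendsto (fun r => Real.log (h r) / Real.log r) (𝓝[>] 0) (𝓝 α) := by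
  have hl2 : 0 < Real.log 2 := Real.log_pos one_lt_two
  rw [Metric.tendsto_nhds]
  intro ε' hε'
  obtain ⟨ε, hε, hε1, hεε'⟩ : ∃ ε > 0, ε ≤ 1 ∧ ε * (3 * |α| + 5) < ε' := by
    have hpos : 0 < 3 * |α| + 5 := by positivity
    refine ⟨min 1 (ε' / (2 * (3 * |α| + 5))), by positivity, min_le_left _ _, ?_⟩
    calc _ ≤ ε' / (2 * (3 * |α| + 5)) * (3 * |α| + 5) := by gcongr; exact min_le_right _ _
      _ = ε' / 2 := by field_simp
      _ < ε' := by linarith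
  obtain ⟨J, hJ⟩ := eventually_atTop.1 ((hu ε hε).and (hm ε hε))
  filter_upwards [Ioo_mem_nhdsGT (rad_pos (n J)), eventually_Ioo_zero_one] with r hr hr1
  -- the level `k` with `2 ^ (-n (k + 1)) ≤ r < 2 ^ (-n k)`
  obtain ⟨k, hkJ, hk1, hk2⟩ : ∃ k ≥ J, rad (n (k + 1)) ≤ r ∧ r < rad (n k) := by
    classical
    have hex : ∃ k, rad (n k) ≤ r :=
      (((tendsto_rad.comp hn.tendsto_atTop).eventually_lt_const hr.1).exists).imp fun _ h => h.le
    have hJlt : J < Nat.find hex := by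
      by_contra! hle
      have := rad_antitone (hn.monotone hle)
      linarith [Nat.find_spec hex, hr.2]
    refine ⟨Nat.find hex - 1, by omega, ?_, not_le.1 (Nat.find_min hex (by omega))⟩
    rw [Nat.sub_add_cancel (by omega)]
    exact Nat.find_spec hex
  have hlogr : Real.log r < 0 := Real.log_neg hr1.1 hr1.2
  have hrad : ∀ j, Real.log (rad j) = -(j : ℝ) * Real.log 2 := fun j => by
    rw [rad_eq_rpow, Real.log_rpow two_pos]
  have hL1 : (n k : ℝ) * Real.log 2 ≤ -Real.log r := by
    have := Real.log_le_log hr1.1 hk2.le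
    rw [hrad] at this
    linarith
  have hL2 : -Real.log r ≤ (n (k + 1) : ℝ) * Real.log 2 := by
    have := Real.log_le_log (rad_pos _) hk1
    rw [hrad] at this
    linarith
  have hlow : (2 : ℝ) ^ (-(α * n (k + 2) + u (k + 2))) ≤ h r := by
    refine (hlo (k + 2)).trans (hmono (le_trans ?_ hk1))
    rw [← rad_succ (n (k + 1))]
    have := rad_antitone (Nat.succ_le_of_lt (hn (show k + 1 < k + 2 by omega)))
    rw [Nat.succ_eq_add_one] at this
    linarith
  have hhpos : 0 < h r := (Real.rpow_pos_of_pos two_pos _).trans_le hlow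
  have hH1 : (α * n k - u k) * Real.log 2 ≤ -Real.log (h r) := by
    have := Real.log_le_log hhpos ((hmono hk2.le).trans (hup k))
    rw [Real.log_rpow two_pos] at this
    linarith
  have hH2 : -Real.log (h r) ≤ (α * n (k + 2) + u (k + 2)) * Real.log 2 := by
    have := Real.log_le_log (Real.rpow_pos_of_pos two_pos _) hlow
    rw [Real.log_rpow two_pos] at this
    linarith
  obtain ⟨u0, m0⟩ := hJ k hkJ
  obtain ⟨-, m1⟩ := hJ (k + 1) (by omega)
  obtain ⟨u2, -⟩ := hJ (k + 2) (by omega)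
  have hn0 : (n k : ℝ) ≤ n (k + 1) := by exact_mod_cast (hn k.lt_succ_self).le
  have hn1 : (n (k + 1) : ℝ) ≤ n (k + 2) := by exact_mod_cast (hn (k + 1).lt_succ_self).le
  rw [show k + 1 + 1 = k + 2 from rfl] at m1
  have hnn : (0 : ℝ) ≤ n k := Nat.cast_nonneg _
  generalize (n k : ℝ) = a at *
  generalize (n (k + 1) : ℝ) = b at *
  generalize (n (k + 2) : ℝ) = c at *
  have hb : b ≤ 2 * a := by nlinarith
  have hc : c ≤ 4 * a := by nlinarith
  have hca : c - a ≤ 3 * ε * a := by nlinarith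
  have hu2 : u (k + 2) ≤ 4 * ε * a := by nlinarith
  rw [Real.dist_eq, ← neg_div_neg_eq, div_sub' (by linarith), abs_div, abs_of_pos (neg_pos.2 hlogr)]
  rw [div_lt_iff₀ (neg_pos.2 hlogr)]
  have hkey : |-Real.log (h r) - -Real.log r * α| ≤ ε * (3 * |α| + 5) * (a * Real.log 2) := by
    set L := -Real.log r / Real.log 2 with hL
    have hLeq : -Real.log r = L * Real.log 2 := by rw [hL]; field_simp
    rw [hLeq] at hL1 hL2 ⊢
    have hL1' := le_of_mul_le_mul_right hL1 hl2
    have hL2' := le_of_mul_le_mul_right hL2 hl2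
    -- both `α a` and `α c` differ from `α L` by at most `|α| (c - a)`
    have e1 : |α * (L - a)| ≤ |α| * (3 * ε * a) := by
      rw [abs_mul, abs_of_nonneg (by linarith : 0 ≤ L - a)]
      gcongr
      linarith
    have e2 : |α * (c - L)| ≤ |α| * (3 * ε * a) := by
      rw [abs_mul, abs_of_nonneg (by linarith : 0 ≤ c - L)]
      gcongr
      linarith
    rw [abs_le] at e1 e2 ⊢
    constructor
    · have : -(ε * (3 * |α| + 5) * a) ≤ α * a - u k - L * α := by nlinarith
      nlinarith
    · have : α * c + u (k + 2) - L * α ≤ ε * (3 * |α| + 5) * a := by nlinarith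
      nlinarith
  refine hkey.trans_lt ?_
  calc ε * (3 * |α| + 5) * (a * Real.log 2) ≤ ε * (3 * |α| + 5) * -Real.log r := by gcongr
    _ < ε' * -Real.log r := by
        gcongr
        linarith

variable {d : ℕ} {μ : Measure (EuclideanSpace ℝ (Fin d))} {α s lam : ℝ} {R ε : ℕ → ℝ} {M : ℕ → ℕ}
  {β σ : Bool → ℕ → ℝ}

/-- The greedy choice of the exponents: the exponent that is (almost) at least `α` is used while the
accumulated deviation `Δ` from `α` is non-positive, the other one while it is positive. -/
theorem exists_levels (M : ℕ → ℕ) (β : Bool → ℕ → ℝ) (α : ℝ) (n₀ : ℕ) :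
    ∃ (n : ℕ → ℕ) (Δ : ℕ → ℝ) (i : ℕ → Bool), n 0 = n₀ ∧ (∀ j, n (j + 1) = n j + M (n j)) ∧
      Δ 0 = 0 ∧ (∀ j, Δ (j + 1) = Δ j + M (n j) * (β (i j) (n j) - α)) ∧
      ∀ j, i j = true ↔ Δ j ≤ 0 := by
  classical
  let nxt : ℕ × ℝ → ℕ × ℝ := fun x =>
    (x.1 + M x.1, x.2 + M x.1 * (β (decide (x.2 ≤ 0)) x.1 - α))
  let seq : ℕ → ℕ × ℝ := fun j => nxt^[j] (n₀, 0)
  have hseq : ∀ j, seq (j + 1) = nxt (seq j) := fun j => Function.iterate_succ_apply' nxt j _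
  refine ⟨fun j => (seq j).1, fun j => (seq j).2, fun j => decide ((seq j).2 ≤ 0), rfl,
    fun j => ?_, rfl, fun j => ?_, fun j => by simp⟩
  · simp only [hseq, nxt]
  · simp only [hseq, nxt]

theorem abs_add_le_max {Δ x e b : ℝ} (hx : |x| ≤ b) (h0 : Δ ≤ 0 → -e ≤ x) (h1 : 0 < Δ → x ≤ e) :
    |Δ + x| ≤ max (|Δ| + e) b := by
  rw [le_max_iff]
  obtain ⟨hx1, hx2⟩ := abs_le.1 hx
  rcases le_or_gt Δ 0 with h | h
  · have := h0 h
    rw [abs_of_nonpos h]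
    rcases le_or_gt (Δ + x) 0 with h' | h'
    · left; rw [abs_of_nonpos h']; linarith
    · right; rw [abs_of_pos h']; linarith
  · have := h1 h
    rw [abs_of_pos h]
    rcases le_or_gt (Δ + x) 0 with h' | h'
    · right; rw [abs_of_nonpos h']; linarith
    · left; rw [abs_of_pos h']; linarith

end Levels

/-! ### Level sets contain the limit set of a tree -/

section Construction

variable {d : ℕ} {μ : Measure (EuclideanSpace ℝ (Fin d))} {α s lam : ℝ} {R ε : ℕ → ℝ} {M : ℕ → ℕ}
  {β σ : Bool → ℕ → ℝ}

theorem HasBoxes.exists_family {β σ ε R : ℝ} {n m : ℕ} {x : EuclideanSpace ℝ (Fin d)}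
    (h : HasBoxes μ β σ ε R n m x) :
    ∃ c : Fin ⌈(2 : ℝ) ^ ((m : ℝ) * (σ - ε))⌉₊ → EuclideanSpace ℝ (Fin d),
      (∀ i, closedBall (c i) (rad (n + m)) ⊆ closedBall x (rad n) ∧
        (2 : ℝ) ^ (-(m : ℝ) * (β + ε)) * μ.real (closedBall x (rad n)) ≤
          μ.real (closedBall (c i) (rad (n + m))) ∧
        μ.real (closedBall (c i) (rad (n + m))) ≤
          (2 : ℝ) ^ (-(m : ℝ) * (β - ε)) * μ.real (closedBall x (rad n)) ∧
        c i ∈ doublingCentres μ R (n + m)) ∧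
      Pairwise fun i i' => Disjoint (closedBall (c i) (rad (n + m)))
        (closedBall (c i') (rad (n + m))) := by
  obtain ⟨F, hF, hcard, hprop⟩ := h
  have hle : ⌈(2 : ℝ) ^ ((m : ℝ) * (σ - ε))⌉₊ ≤ F.card := Nat.ceil_le.2 hcard
  refine ⟨fun i => (F.equivFin.symm (Fin.castLE hle i) : EuclideanSpace ℝ (Fin d)),
    fun i => hprop _ (F.equivFin.symm (Fin.castLE hle i)).2, fun i i' hne => ?_⟩
  refine hF (F.equivFin.symm (Fin.castLE hle i)).2 (F.equivFin.symm (Fin.castLE hle i')).2 ?_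
  intro heq
  exact hne (Fin.castLE_injective hle (F.equivFin.symm.injective (Subtype.ext heq)))

/-- The construction of points with local dimension `α` along a schedule. -/
theorem IsSchedule.le_dimH_levelSet [IsFiniteMeasure μ] (h : IsSchedule μ α s lam R ε M β σ) :
    (levelSet μ α).Nonempty ∧ ENNReal.ofReal s ≤ dimH (levelSet μ α) := by
  obtain ⟨n₀, hn₀⟩ := eventually_atTop.1 (h.constant_le.and h.mul_le)
  obtain ⟨n₁, ⟨y₀, hy₀⟩, hn₁⟩ := (h.nonempty.and (eventually_ge_atTop n₀)).exists
  obtain ⟨n, Δ, i, hn0, hnM, hΔ0, hΔ, hi⟩ := exists_levels M β α n₁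
  have hn : StrictMono n := strictMono_nat_of_lt_succ fun j => by
    have := h.one_le (n j)
    have := hnM j
    omega
  have hge : ∀ j, n₀ ≤ n j := fun j => by
    have := hn.monotone (Nat.zero_le j)
    omega
  have hεn : Tendsto (fun j => ε (n j)) atTop (𝓝 0) := h.eps_tendsto.comp hn.tendsto_atTop
  have hMn : ∀ j, (M (n j) : ℝ) = n (j + 1) - n j := fun j => by
    rw [hnM]; push_cast; ring
  -- the accumulated errors are negligible
  let e : ℕ → ℝ := fun j => ∑ k ∈ Finset.range j, M (n k) * ε (n k)
  have he0 : ∀ j, 0 ≤ e j := fun j => Finset.sum_nonneg fun k _ =>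
    mul_nonneg (Nat.cast_nonneg _) (h.eps_pos _).le
  have he : ∀ j, e (j + 1) = e j + M (n j) * ε (n j) := fun j => Finset.sum_range_succ _ _
  have heo : ∀ δ > 0, ∀ᶠ j in atTop, e j ≤ δ * n j := fun δ hδ =>
    eventually_le_mul_of_le_max hn hεn (fun j => le_max_of_le_left (by
      rw [he, hMn]; linarith)) hδ
  have hmul : ∀ j, M (n j) * |β (i j) (n j) - α| ≤ ε (n j) * n j := fun j => by
    have h1 := (hn₀ (n j) (hge j)).2 (i j)
    have h2 : (0 : ℝ) ≤ M (n j) := Nat.cast_nonneg _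
    linarith
  have hΔo : ∀ δ > 0, ∀ᶠ j in atTop, |Δ j| ≤ δ * n j := fun δ hδ =>
    eventually_le_mul_of_le_max hn hεn (fun j => by
      rw [hΔ, ← hMn]
      have hM0 : (0 : ℝ) ≤ M (n j) := Nat.cast_nonneg _
      refine abs_add_le_max ?_ (fun hle => ?_) fun hgt => ?_
      · rw [abs_mul, abs_of_nonneg hM0]
        exact hmul j
      · rw [(hi j).2 hle]
        have := mul_le_mul_of_nonneg_left (h.le_beta (n j)) hM0
        linarith
      · have hif : i j = false := by
          rw [← Bool.not_eq_true, hi j]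
          exact hgt.not_ge
        rw [hif]
        have := mul_le_mul_of_nonneg_left (h.beta_le (n j)) hM0
        linarith) hδ
  have hmo : ∀ δ > 0, ∀ᶠ j in atTop, (n (j + 1) : ℝ) - n j ≤ δ * n j := fun δ hδ => by
    filter_upwards [hεn.eventually_lt_const hδ] with j hj
    have h1 := (hn₀ (n j) (hge j)).2 true
    have h2 := mul_nonneg (Nat.cast_nonneg (α := ℝ) (M (n j))) (abs_nonneg (β true (n j) - α))
    have h3 := mul_le_mul_of_nonneg_right hj.le (Nat.cast_nonneg (α := ℝ) (n j))
    rw [← hMn]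
    linarith
  have hconst : ∀ C δ : ℝ, 0 < δ → ∀ᶠ j in atTop, C ≤ δ * n j := fun C δ hδ =>
    ((tendsto_natCast_atTop_atTop.comp hn.tendsto_atTop).const_mul_atTop hδ).eventually_ge_atTop C
  have hεo : ∀ δ > 0, ∀ᶠ j in atTop, ε (n j) * n j ≤ δ * n j := fun δ hδ => by
    filter_upwards [hεn.eventually_lt_const hδ] with j hj
    exact mul_le_mul_of_nonneg_right hj.le (Nat.cast_nonneg _)
  -- the tree of balls
  let A : ℕ → ℝ := fun j => α * (n j - n₁) + Δ j
  have hA : ∀ j, A (j + 1) = A j + M (n j) * β (i j) (n j) := fun j => by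
    simp only [A, hΔ, hMn]; ring
  set c₀ := μ.real (closedBall y₀ (rad n₁)) with hc₀
  have hc₀pos : 0 < c₀ :=
    hy₀.1.trans_le (measureReal_mono (closedBall_subset_closedBall (rad_antitone n₁.le_succ)))
  let G : ℕ → Set (EuclideanSpace ℝ (Fin d)) := fun j =>
    {y | y ∈ doublingCentres μ (R (n j)) (n j) ∧
      (2 : ℝ) ^ (-(A j + e j)) * c₀ ≤ μ.real (closedBall y (rad (n j))) ∧
      μ.real (closedBall y (rad (n j))) ≤ (2 : ℝ) ^ (-(A j - e j)) * c₀}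
  have hG0 : y₀ ∈ G 0 := by
    refine ⟨by rwa [hn0], ?_, ?_⟩ <;> simp [A, e, hn0, hΔ0, hc₀]
  let N : ℕ → ℕ := fun j => ⌈(2 : ℝ) ^ ((M (n j) : ℝ) * (σ (i j) (n j) - ε (n j)))⌉₊
  have hN : ∀ j, 0 < N j := fun j => Nat.ceil_pos.2 (Real.rpow_pos_of_pos two_pos _)
  have hstep : ∀ j x, ∃ c : Fin (N j) → EuclideanSpace ℝ (Fin d), x ∈ G j →
      (∀ i, c i ∈ G (j + 1) ∧ closedBall (c i) (rad (n (j + 1))) ⊆ closedBall x (rad (n j))) ∧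
      Pairwise fun i i' => Disjoint (closedBall (c i) (rad (n (j + 1))))
        (closedBall (c i') (rad (n (j + 1)))) := by
    intro j x
    by_cases hx : x ∈ G j
    · obtain ⟨c, hc, hdis⟩ := (h.hasBoxes (i j) (n j) x hx.1).exists_family
      rw [← hnM j] at hc hdis
      refine ⟨c, fun _ => ⟨fun k => ?_, hdis⟩⟩
      obtain ⟨h1, h2, h3, h4⟩ := hc k
      refine ⟨⟨h4, le_trans ?_ h2, h3.trans ?_⟩, h1⟩
      · calc (2 : ℝ) ^ (-(A (j + 1) + e (j + 1))) * c₀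
            = 2 ^ (-(M (n j) : ℝ) * (β (i j) (n j) + ε (n j))) * (2 ^ (-(A j + e j)) * c₀) := by
              rw [← mul_assoc, ← Real.rpow_add two_pos, hA, he]
              congr 2
              ring
          _ ≤ _ := by
              gcongr
              exact hx.2.1
      · calc 2 ^ (-(M (n j) : ℝ) * (β (i j) (n j) - ε (n j))) * μ.real (closedBall x (rad (n j)))
            ≤ 2 ^ (-(M (n j) : ℝ) * (β (i j) (n j) - ε (n j))) * (2 ^ (-(A j - e j)) * c₀) := by
              gcongr
              exact hx.2.2
          _ = (2 : ℝ) ^ (-(A (j + 1) - e (j + 1))) * c₀ := by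
              rw [← mul_assoc, ← Real.rpow_add two_pos, hA, he]
              congr 2
              ring
    · exact ⟨fun _ => x, fun hx' => absurd hx' hx⟩
  choose c hc using hstep
  have htree : IsTree G (fun j => rad (n j)) c := fun j x hx => hc j x hx
  -- the growth of the number of vertices
  have hprod : ∀ j, (2 : ℝ) ^ (s * (n j - n₁) + lam * Δ j - 2 * e j) ≤
      (∏ k ∈ Finset.range j, N k : ℕ) := fun j => by
    induction j with
    | zero => simp [hn0, hΔ0, e]
    | succ j ih =>
      rw [Finset.prod_range_succ, Nat.cast_mul]
      calc (2 : ℝ) ^ (s * (n (j + 1) - n₁) + lam * Δ (j + 1) - 2 * e (j + 1))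
          ≤ 2 ^ ((s * (n j - n₁) + lam * Δ j - 2 * e j) +
              (M (n j) : ℝ) * (σ (i j) (n j) - ε (n j))) := by
            apply Real.rpow_le_rpow_of_exponent_le one_le_two
            have h1 := mul_le_mul_of_nonneg_left (h.le_sigma (i j) (n j))
              (Nat.cast_nonneg (α := ℝ) (M (n j)))
            have h2 := hMn j
            have h3 : (n (j + 1) : ℝ) = n j + M (n j) := by linarith
            rw [hΔ, he, h3]
            linarith
        _ = _ := Real.rpow_add two_pos _ _
        _ ≤ _ := by
            gcongr
            exact Nat.le_ceil _
  have hdim := htree.le_dimH_limitSet hN hG0 (fun j => rad_pos _)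
    (tendsto_rad.comp hn.tendsto_atTop) (rad_antitone.comp_monotone hn.monotone) (s := s) (by
      intro t ht
      obtain ⟨δ, hδ, hδt⟩ : ∃ δ > 0, δ * (|t| + |s| + |lam| + 3) ≤ s - t :=
        ⟨(s - t) / (|t| + |s| + |lam| + 3), div_pos (by linarith) (by positivity),
          (div_mul_cancel₀ _ (by positivity)).le⟩
      filter_upwards [heo δ hδ, hΔo δ hδ, hmo δ hδ, hconst n₁ δ hδ] with j h1 h2 h3 h4
      refine le_trans ?_ (hprod j)
      rw [rad_eq_rpow, ← Real.rpow_mul two_pos.le]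
      apply Real.rpow_le_rpow_of_exponent_le one_le_two
      have h5 : t * (n (j + 1) - n j) ≤ |t| * (δ * n j) :=
        (mul_le_mul_of_nonneg_right (le_abs_self t) (by
          rw [← hMn]; positivity)).trans (mul_le_mul_of_nonneg_left h3 (abs_nonneg t))
      have h6 : s * n₁ ≤ |s| * (δ * n j) :=
        (mul_le_mul_of_nonneg_right (le_abs_self s) (Nat.cast_nonneg _)).trans
          (mul_le_mul_of_nonneg_left h4 (abs_nonneg s))
      have h7 : -(lam * Δ j) ≤ |lam| * (δ * n j) := by
        refine (neg_le_abs _).trans ?_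
        rw [abs_mul]
        exact mul_le_mul_of_nonneg_left h2 (abs_nonneg lam)
      have h8 := mul_le_mul_of_nonneg_right hδt (Nat.cast_nonneg (α := ℝ) (n j))
      have h9 : 0 ≤ δ * n j := by positivity
      linarith)
  -- the limit points have local dimension `α`
  have hsub : limitSet G (fun j => rad (n j)) ⊆ levelSet μ α := by
    intro x hx
    have hmono : Monotone fun r => μ.real (closedBall x r) := fun r r' hr =>
      measureReal_mono (closedBall_subset_closedBall hr)
    let u : ℕ → ℝ := fun j =>
      |α| * n₁ + |Δ j| + e j + ε (n j) * n j + |Real.logb 2 c₀|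
    have hc₀2 : c₀ = 2 ^ Real.logb 2 c₀ :=
      (Real.rpow_logb two_pos (by norm_num) hc₀pos).symm
    have hα1 : |α * n₁| = |α| * n₁ := by rw [abs_mul, abs_of_nonneg (Nat.cast_nonneg (α := ℝ) n₁)]
    have hε0 : ∀ j, 0 ≤ ε (n j) * n j := fun j => mul_nonneg (h.eps_pos _).le (Nat.cast_nonneg _)
    have hup : ∀ j, μ.real (closedBall x (rad (n j))) ≤ 2 ^ (-(α * n j - u j)) := fun j => by
      obtain ⟨y, ⟨hyd, -, hy2⟩, hxy⟩ := hx j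
      have hRj := (hn₀ (n j) (hge j)).1
      have hsub1 : closedBall x (rad (n j)) ⊆ closedBall y (2 * rad (n j)) :=
        closedBall_subset_closedBall' (by linarith [mem_closedBall.1 hxy])
      have hsub2 : μ.real (closedBall y (rad (n j + 1))) ≤ μ.real (closedBall y (rad (n j))) :=
        measureReal_mono (closedBall_subset_closedBall (rad_antitone (n j).le_succ))
      calc μ.real (closedBall x (rad (n j))) ≤ μ.real (closedBall y (2 * rad (n j))) :=
            measureReal_mono hsub1
        _ ≤ R (n j) * μ.real (closedBall y (rad (n j + 1))) := hyd.2
        _ ≤ 2 ^ (ε (n j) * n j) * ((2 : ℝ) ^ (-(A j - e j)) * c₀) :=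
            mul_le_mul hRj (hsub2.trans hy2) measureReal_nonneg (by positivity)
        _ = 2 ^ (ε (n j) * n j + (-(A j - e j) + Real.logb 2 c₀)) := by
            rw [Real.rpow_add two_pos, Real.rpow_add two_pos, ← hc₀2]
        _ ≤ _ := by
            apply Real.rpow_le_rpow_of_exponent_le one_le_two
            have h1 := neg_abs_le (Δ j)
            have h2 := le_abs_self (Real.logb 2 c₀)
            have h3 := le_abs_self (α * n₁)
            simp only [A, u]
            linarith
    have hlo : ∀ j, (2 : ℝ) ^ (-(α * n j + u j)) ≤ μ.real (closedBall x (2 * rad (n j))) :=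
      fun j => by
      obtain ⟨y, ⟨-, hy1, -⟩, hxy⟩ := hx j
      have hsub1 : closedBall y (rad (n j)) ⊆ closedBall x (2 * rad (n j)) :=
        closedBall_subset_closedBall' (by
          have := mem_closedBall'.1 hxy
          linarith)
      refine le_trans ?_ (hy1.trans (measureReal_mono hsub1))
      calc (2 : ℝ) ^ (-(α * n j + u j)) ≤ 2 ^ (-(A j + e j) + Real.logb 2 c₀) := by
            apply Real.rpow_le_rpow_of_exponent_le one_le_two
            have h1 := le_abs_self (Δ j)
            have h2 := neg_abs_le (Real.logb 2 c₀)
            have h3 := neg_abs_le (α * n₁)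
            have h4 := hε0 j
            simp only [A, u]
            linarith
        _ = _ := by rw [Real.rpow_add two_pos, ← hc₀2]
    refine mem_levelSet_iff.2 ⟨?_, tendsto_log_div_log hmono hn hup hlo ?_ hmo⟩
    · rw [Measure.mem_support_iff_forall]
      intro U hU
      obtain ⟨r, hr, hrU⟩ := Metric.nhds_basis_closedBall.mem_iff.1 hU
      obtain ⟨j, hj⟩ := ((tendsto_rad.comp hn.tendsto_atTop).eventually_lt_const (half_pos hr)).exists
      have hj' : rad (n j) < r / 2 := hj
      have h1 : 0 < μ.real (closedBall x (2 * rad (n j))) :=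
        (Real.rpow_pos_of_pos two_pos _).trans_le (hlo j)
      exact (ENNReal.toReal_pos_iff.1 h1).1.trans_le
        (measure_mono ((closedBall_subset_closedBall (by linarith)).trans hrU))
    · intro δ hδ
      have hδ' : 0 < δ / 5 := by positivity
      filter_upwards [hconst (|α| * n₁) _ hδ', hΔo _ hδ', heo _ hδ', hεo _ hδ',
        hconst |Real.logb 2 c₀| _ hδ'] with j h1 h2 h3 h4 h5
      simp only [u]
      linarith
  exact ⟨hdim.1.mono hsub, hdim.2.trans (dimH_mono hsub)⟩

end Construction

/-! ### The multifractal formalism -/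

section Formalism

variable {d : ℕ} {μ : Measure (EuclideanSpace ℝ (Fin d))}

theorem support_nonempty_of_lqSpectrum_ne_top {q : ℝ} (h : lqSpectrum μ q ≠ ⊤) :
    μ.support.Nonempty := by
  by_contra hne
  rw [not_nonempty_iff_eq_empty] at hne
  refine h ((EReal.eq_top_iff_forall_lt _).2 fun y => ?_)
  have h0 : ∀ r, packingSum μ q r = 0 := fun r => by
    refine le_antisymm (iSup_le fun F => iSup_le fun hF => iSup_le fun _ => ?_) zero_le
    rw [hne, subset_empty_iff, Finset.coe_eq_empty] at hF
    simp [hF]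
  refine lt_of_lt_of_le (EReal.coe_lt_coe_iff.2 (lt_add_one y))
    (le_lqSpectrum_of_eventually (Eventually.of_forall fun r => ?_))
  rw [h0]
  exact zero_le

theorem legendre_le (hfin : ∀ q : ℝ, lqSpectrum μ q ≠ ⊥ ∧ lqSpectrum μ q ≠ ⊤) (α q : ℝ) :
    legendre μ α ≤ ((α * q - tau μ q : ℝ) : EReal) := by
  rw [EReal.coe_sub, coe_tau (hfin q)]
  exact iInf_le _ q

variable [IsFiniteMeasure μ]

/-- The lower bound at all points `(α, s)` that are approximated by convex combinations of two points
`(τ'(q), q τ'(q) - τ(q))`. The combinations need not be given explicitly: it is enough that there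
are points on both sides of `α` which are almost above a line of some slope through `(α, s)`. -/
theorem le_dimH_levelSet_of_localBoxCounting
    (hfin : ∀ q : ℝ, lqSpectrum μ q ≠ ⊥ ∧ lqSpectrum μ q ≠ ⊤) {α s lam : ℝ}
    (h : ∀ ε > 0, ∃ q₁ q₂, LocalBoxCounting μ q₁ ∧ LocalBoxCounting μ q₂ ∧
      α - ε ≤ deriv (tau μ) q₁ ∧ deriv (tau μ) q₂ ≤ α + ε ∧
      s + lam * (deriv (tau μ) q₁ - α) - ε ≤ deriv (tau μ) q₁ * q₁ - tau μ q₁ ∧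
      s + lam * (deriv (tau μ) q₂ - α) - ε ≤ deriv (tau μ) q₂ * q₂ - tau μ q₂) :
    (levelSet μ α).Nonempty ∧ ENNReal.ofReal s ≤ dimH (levelSet μ α) := by
  obtain ⟨R, ε, M, β, σ, hS⟩ := exists_isSchedule (μ := μ) (α := α) (s := s) (lam := lam)
    (support_nonempty_of_lqSpectrum_ne_top (hfin 0).2) (fun ε hε => by
      obtain ⟨q₁, q₂, h1, h2, h3, h4, h5, h6⟩ := h ε hε
      exact ⟨fun i => bif i then q₁ else q₂, Bool.forall_bool.2 ⟨h2, h1⟩, h3, h4,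
        Bool.forall_bool.2 ⟨h6, h5⟩⟩)
  exact hS.le_dimH_levelSet

theorem dimH_levelSet_eq_legendre
    (hfin : ∀ q : ℝ, lqSpectrum μ q ≠ ⊥ ∧ lqSpectrum μ q ≠ ⊤) {α s : ℝ}
    (hle : legendre μ α ≤ (s : EReal))
    (h : (levelSet μ α).Nonempty ∧ ENNReal.ofReal s ≤ dimH (levelSet μ α)) :
    ((dimH (levelSet μ α) : ℝ≥0∞) : EReal) = legendre μ α := by
  apply le_antisymm
  · refine le_iInf fun q => ?_
    rw [← coe_tau (hfin q), ← EReal.coe_sub]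
    refine (EReal.coe_ennreal_le_coe_ennreal_iff.2 (dimH_levelSet_le hfin α q)).trans ?_
    rw [EReal.coe_ennreal_ofReal, max_eq_left (nonneg_of_levelSet_nonempty hfin h.1 q)]
  · refine hle.trans (le_trans ?_ (EReal.coe_ennreal_le_coe_ennreal_iff.2 h.2))
    rw [EReal.coe_ennreal_ofReal]
    exact_mod_cast le_max_left s 0

/-- The multifractal formalism at the limits of slopes `τ'(q)`. -/
theorem multifractal_of_tendsto_deriv
    (hfin : ∀ q : ℝ, lqSpectrum μ q ≠ ⊥ ∧ lqSpectrum μ q ≠ ⊤) {α : ℝ}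
    (h : ∀ ε > 0, ∃ q, LocalBoxCounting μ q ∧ α - ε ≤ deriv (tau μ) q ∧ deriv (tau μ) q ≤ α + ε ∧
      legendre μ α ≤ ((deriv (tau μ) q * q - tau μ q + ε : ℝ) : EReal)) :
    (levelSet μ α).Nonempty ∧ ((dimH (levelSet μ α) : ℝ≥0∞) : EReal) = legendre μ α := by
  have htop : legendre μ α ≠ ⊤ :=
    ne_top_of_le_ne_top (EReal.coe_ne_top _) (legendre_le hfin α 0)
  -- if the infimum were `-∞`, non-negativity of `q τ'(q) - τ(q)` would still produce points of `E(α)`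
  have hnn : ∀ q, LocalBoxCounting μ q → 0 ≤ deriv (tau μ) q * q - tau μ q := fun q hq =>
    nonneg_of_levelSet_nonempty hfin (le_dimH_levelSet_of_localBoxCounting hfin
      (s := deriv (tau μ) q * q - tau μ q) (lam := 0) fun ε hε =>
        ⟨q, q, hq, hq, by linarith, by linarith, by linarith, by linarith⟩).1 q
  obtain ⟨s, hls, hs⟩ : ∃ s : ℝ, legendre μ α ≤ s ∧
      ∀ q ε : ℝ, LocalBoxCounting μ q → 0 < ε →
        legendre μ α ≤ ((deriv (tau μ) q * q - tau μ q + ε : ℝ) : EReal) →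
        s ≤ deriv (tau μ) q * q - tau μ q + ε := by
    by_cases hbot : legendre μ α = ⊥
    · exact ⟨0, by simp [hbot], fun q ε hq hε _ => by linarith [hnn q hq]⟩
    · refine ⟨(legendre μ α).toReal, (EReal.coe_toReal htop hbot).ge, fun q ε _ _ hle => ?_⟩
      rw [← EReal.coe_toReal htop hbot] at hle
      exact_mod_cast hle
  have hmain := le_dimH_levelSet_of_localBoxCounting hfin (α := α) (s := s) (lam := 0)
    fun ε hε => by
      obtain ⟨q, hq, h1, h2, h3⟩ := h ε hε
      have := hs q ε hq hε h3
      exact ⟨q, q, hq, hq, h1, h2, by linarith, by linarith⟩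
  exact ⟨hmain.1, dimH_levelSet_eq_legendre hfin hls hmain⟩

/-- The multifractal formalism for the numbers `α` between the limit slope at `+∞` and some slope
`τ'(q)`. -/
theorem multifractal_of_le_deriv
    (hfin : ∀ q : ℝ, lqSpectrum μ q ≠ ⊥ ∧ lqSpectrum μ q ≠ ⊤) {I Λ : Set ℝ} (hI : IsOpen I)
    (hIc : I.OrdConnected) (hI0 : Ioi 0 ⊆ I) (hΛ : Λ ⊆ {q ∈ I | DifferentiableAt ℝ (tau μ) q})
    (hdense : {q ∈ I | DifferentiableAt ℝ (tau μ) q} ⊆ closure Λ)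
    (hbox : ∀ q ∈ Λ, LocalBoxCounting μ q) {α a : ℝ}
    (ha : Tendsto (fun q => tau μ q / q) atTop (𝓝 a)) (haα : a ≤ α)
    (hα : ∃ q ∈ Λ, α ≤ deriv (tau μ) q) :
    (levelSet μ α).Nonempty ∧ ((dimH (levelSet μ α) : ℝ≥0∞) : EReal) = legendre μ α := by
  have hconc := concaveOn_tau hfin
  have hmono := monotone_tau hfin
  have hcont : Continuous (tau μ) := hconc.locallyLipschitz.continuous
  by_cases hα' : ∃ q ∈ Λ, deriv (tau μ) q ≤ α
  · obtain ⟨q₁, hq₁, h₁⟩ := hα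
    obtain ⟨q₂, hq₂, h₂⟩ := hα'
    obtain ⟨q, hqI, hq⟩ := exists_supporting_slope hconc hcont hIc (hΛ hq₁).1 (hΛ hq₂).1
      (hΛ hq₁).2 (hΛ hq₂).2 h₁ h₂
    have hmain := le_dimH_levelSet_of_localBoxCounting hfin (α := α) (s := α * q - tau μ q)
      (lam := q) fun ε hε => by
        obtain ⟨p₁, hp₁, p₂, hp₂, e1, e2, e3, e4⟩ :=
          exists_near_supporting_slope hconc hcont hmono hI hΛ hdense hqI hq hε
        exact ⟨p₁, p₂, hbox _ hp₁, hbox _ hp₂, by linarith, by linarith, e3, e4⟩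
    exact ⟨hmain.1, dimH_levelSet_eq_legendre hfin (legendre_le hfin α q) hmain⟩
  · push Not at hα'
    refine multifractal_of_tendsto_deriv hfin fun ε hε => ?_
    obtain ⟨X, hX⟩ := eventually_atTop.1 (eventually_deriv_le hconc hε ha)
    obtain ⟨q, hqΛ, hq⟩ := exists_mem_of_isOpen hmono hI hdense (isOpen_Ioi (a := max X 0))
      ⟨max X 0 + 1, mem_Ioi.2 (lt_add_one _), hI0 (lt_of_le_of_lt (le_max_right X 0) (lt_add_one _))⟩
    have hq0 : 0 < q := (le_max_right X 0).trans_lt hq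
    have h1 := hX q ((le_max_left X 0).trans hq.le) (hΛ hqΛ).2
    have h2 := hα' q hqΛ
    refine ⟨q, hbox q hqΛ, by linarith, by linarith, (legendre_le hfin α q).trans ?_⟩
    rw [EReal.coe_le_coe_iff]
    nlinarith

theorem le_of_levelSet_nonempty (hfin : ∀ q : ℝ, lqSpectrum μ q ≠ ⊥ ∧ lqSpectrum μ q ≠ ⊤) {α : ℝ}
    {a : ℝ} {b : EReal} (ha : Tendsto (fun q => tau μ q / q) atTop (𝓝 a))
    (hb : Tendsto (fun q : ℝ => ((tau μ q / q : ℝ) : EReal)) atBot (𝓝 b))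
    (hne : (levelSet μ α).Nonempty) : a ≤ α ∧ (α : EReal) ≤ b := by
  have h := nonneg_of_levelSet_nonempty hfin hne
  constructor
  · refine le_of_tendsto ha ?_
    filter_upwards [eventually_gt_atTop 0] with q hq
    rw [div_le_iff₀ hq]
    linarith [h q]
  · refine ge_of_tendsto hb ?_
    filter_upwards [eventually_lt_atBot 0] with q hq
    rw [EReal.coe_le_coe_iff, le_div_iff_of_neg hq]
    linarith [h q]

theorem multifractal_of_hasGoodStructure_univ
    (hfin : ∀ q : ℝ, lqSpectrum μ q ≠ ⊥ ∧ lqSpectrum μ q ≠ ⊤) (hgood : HasGoodStructure μ univ)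
    {α a : ℝ} {b : EReal} (ha : Tendsto (fun q => tau μ q / q) atTop (𝓝 a))
    (hb : Tendsto (fun q : ℝ => ((tau μ q / q : ℝ) : EReal)) atBot (𝓝 b)) (haα : a ≤ α)
    (hαb : (α : EReal) ≤ b) :
    (levelSet μ α).Nonempty ∧ ((dimH (levelSet μ α) : ℝ≥0∞) : EReal) = legendre μ α := by
  obtain ⟨Λ, hΛ, hdense, hbox⟩ := hgood
  by_cases hα : ∃ q ∈ Λ, α ≤ deriv (tau μ) q
  · exact multifractal_of_le_deriv hfin isOpen_univ ordConnected_univ (subset_univ _) hΛ hdense hbox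
      ha haα hα
  push Not at hα
  refine multifractal_of_tendsto_deriv hfin fun ε hε => ?_
  obtain ⟨X, hX⟩ := eventually_atBot.1
    (eventually_le_deriv (concaveOn_tau hfin) hαb (sub_lt_self α hε) hb)
  obtain ⟨q, hqΛ, hq⟩ := exists_mem_of_isOpen (monotone_tau hfin) isOpen_univ hdense
    (isOpen_Iio (a := min X 0)) ⟨min X 0 - 1, mem_Iio.2 (sub_one_lt _), mem_univ _⟩
  have hq0 : q < 0 := lt_of_lt_of_le hq (min_le_right X 0)
  have h1 := hX q (le_of_lt (lt_of_lt_of_le hq (min_le_left X 0))) (hΛ hqΛ).2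
  have h2 := hα q hqΛ
  refine ⟨q, hbox q hqΛ, h1, by linarith, (legendre_le hfin α q).trans ?_⟩
  rw [EReal.coe_le_coe_iff]
  nlinarith

theorem multifractal_of_hasGoodStructure_Ioi
    (hfin : ∀ q : ℝ, lqSpectrum μ q ≠ ⊥ ∧ lqSpectrum μ q ≠ ⊤)
    (hgood : HasGoodStructure μ (Ioi 0)) {α a δ : ℝ}
    (ha : Tendsto (fun q => tau μ q / q) atTop (𝓝 a))
    (hδ : HasDerivWithinAt (tau μ) δ (Ioi 0) 0) (haα : a ≤ α) (hαδ : α ≤ δ) :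
    (levelSet μ α).Nonempty ∧ ((dimH (levelSet μ α) : ℝ≥0∞) : EReal) = legendre μ α := by
  obtain ⟨Λ, hΛ, hdense, hbox⟩ := hgood
  by_cases hα : ∃ q ∈ Λ, α ≤ deriv (tau μ) q
  · exact multifractal_of_le_deriv hfin isOpen_Ioi ordConnected_Ioi subset_rfl hΛ hdense hbox
      ha haα hα
  push Not at hα
  have hcont : Continuous (tau μ) := (concaveOn_tau hfin).locallyLipschitz.continuous
  refine multifractal_of_tendsto_deriv hfin fun ε hε => ?_
  have hev : ∀ᶠ q in 𝓝[>] (0 : ℝ), (DifferentiableAt ℝ (tau μ) q → δ - ε ≤ deriv (tau μ) q) ∧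
      tau μ q < tau μ 0 + ε :=
    (eventually_le_deriv_nhdsGT (concaveOn_tau hfin) hcont hε hδ).and
      ((hcont.tendsto 0).eventually_lt_const (lt_add_of_pos_right _ hε) |>.filter_mono
        nhdsWithin_le_nhds)
  obtain ⟨X, hX0, hX⟩ := mem_nhdsGT_iff_exists_Ioo_subset.1 hev
  have hX0 : 0 < X := hX0
  obtain ⟨q, hqΛ, hq⟩ := exists_mem_of_isOpen (monotone_tau hfin) isOpen_Ioi hdense
    (isOpen_Ioo (a := 0) (b := X)) ⟨X / 2, ⟨by linarith, by linarith⟩, half_pos hX0⟩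
  obtain ⟨h1, h2⟩ := hX hq
  have h1 := h1 (hΛ hqΛ).2
  have h3 := hα q hqΛ
  refine ⟨q, hbox q hqΛ, by linarith, by linarith, (legendre_le hfin α 0).trans ?_⟩
  rw [EReal.coe_le_coe_iff]
  have := mul_nonneg ((monotone_tau hfin).deriv_nonneg (x := q)) hq.1.le
  linarith

end Formalism

end Multifractal

open Multifractal
theorem theorem2p1 {d : ℕ} (μ : Measure (EuclideanSpace ℝ (Fin d))) [IsFiniteMeasure μ]
    (hsupp : IsCompact μ.support)
    (hfin : ∀ q : ℝ, lqSpectrum μ q ≠ ⊥ ∧ lqSpectrum μ q ≠ ⊤) :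
    ∃ (αmin : ℝ) (αmax : EReal) (δ : ℝ),
      Tendsto (fun q : ℝ => tau μ q / q) atTop (𝓝 αmin) ∧ 0 ≤ αmin ∧
      Tendsto (fun q : ℝ => ((tau μ q / q : ℝ) : EReal)) atBot (𝓝 αmax) ∧
      HasDerivWithinAt (tau μ) δ (Ioi 0) 0 ∧
      (HasGoodStructure μ univ →
        (∀ α : ℝ, (levelSet μ α).Nonempty ↔ αmin ≤ α ∧ (α : EReal) ≤ αmax) ∧
        (∀ α : ℝ, αmin ≤ α → (α : EReal) ≤ αmax →
          ((dimH (levelSet μ α) : ℝ≥0∞) : EReal) = legendre μ α)) ∧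
      (HasGoodStructure μ (Ioi 0) →
        ∀ α ∈ Icc αmin δ, (levelSet μ α).Nonempty ∧
          ((dimH (levelSet μ α) : ℝ≥0∞) : EReal) = legendre μ α) := by
  have hconc := concaveOn_tau hfin
  obtain ⟨a, ha0, ha⟩ := exists_tendsto_div_atTop hconc (monotone_tau hfin)
  obtain ⟨b, hb⟩ := exists_tendsto_div_atBot hconc
  have hd : DifferentiableWithinAt ℝ (tau μ) (Ioi 0) 0 := by
    have := hconc.neg.differentiableWithinAt_Ioi_of_mem_interior (x := 0) (by simp)
    simpa using this.neg
  refine ⟨a, b, _, ha, ha0, hb, hd.hasDerivWithinAt, fun hgood => ⟨fun α => ⟨?_, ?_⟩, ?_⟩, ?_⟩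
  · exact le_of_levelSet_nonempty hfin ha hb
  · exact fun h => (multifractal_of_hasGoodStructure_univ hfin hgood ha hb h.1 h.2).1
  · exact fun α h1 h2 => (multifractal_of_hasGoodStructure_univ hfin hgood ha hb h1 h2).2
  · exact fun hgood α hα =>
      multifractal_of_hasGoodStructure_Ioi hfin hgood ha hd.hasDerivWithinAt hα.1 hα.2
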